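/- **Theorem.** Checking artifact termination of unidirectional BAUML models is undecidable: there is no algorithm which, given (a code of) a unidirectional BAUML model $\mathcal B$ whose constraints are satisfied by the empty information base, decides whether $\mathcal B$, started from the empty information base, satisfies the artifact termination property. No bound is imposed on the multiplicities of association roles. *Models.* A BAUML model is a tuple $\mathcal B=\langle \mathcal M,\mathcal O,\mathcal S,\mathcal P\rangle$, where: - $\mathcal M$ is a UML class diagram (classes, an acyclic subclass relation, binary associations with a role and a multiplicity at each end, single-valued attributes), whose classes and associations are partitioned into read-only and read-write ones. Some classes are artifacts; each artifact is the top of a hierarchy of read-write classes (with no class in two such hierarchies) whose leaves are the states of the artifact, one of them being its termination state $t_A$. - $\mathcal O$ is a finite set of OCL constraints. - $\mathcal S$ contains one state transition diagram per artifact, over its states. Each transition carries an event and an OCL condition; initial transitions lead to the initial state and create an artifact instance. - $\mathcal P$ contains one activity diagram per event, built from initial, final, action, decision, merge, fork and join nodes. Each action is a task with an OCL precondition and postcondition. Each task takes an artifact instance in input, except the $\mathit{init}$ operations, which belong to initial transitions and return a newly created instance (and tasks of initial transitions executed before that creation). OCL expressions are built with Boolean connectives and quantification from inclusion and emptiness tests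 on paths $o.r_1\cdots r_n$ (with $o$ a variable or $C.\mathrm{allInstances}()$, possibly with @pre), equality comparison of data values drawn from a countably infinite unordered domain, $\mathrm{oclIsNew}$, $\mathrm{oclIsTypeOf}$ and $\mathrm{oclIsKindOf}$. *Unidirectional models.* An OCL expression is navigational if each of its paths either starts from a variable (the artifact instance or a variable of the expression) or uses only read-only names. $\mathcal B$ is navigational if all its conditions, and the pre- and postconditions of all its tasks other than $\mathit{init}$ operations, are navigational. A role is a target role if some OCL expression of $\mathcal B$ mentions it. A class $D$ depends on a class $C$ if there are $n\ge 1$, classes $C=C_1,\dots,C_{n+1}=D$ and associations $A_1,\dots,A_n$ such that $A_i$ connects $C_i$ and $C_{i+1}$ and the role of $A_i$ attached to $C_{i+1}$ is a target role. $\mathcal B$ is unidirectional if it is navigational and no read-write class depends on itself or on one of its super- or subclasses. *Semantics.* An information base is a finite set of facts giving each object one direct class, the links, and the attribute values; it is legal if it respects $\mathcal M$ and $\mathcal O$ and every artifact instance is in one of its states. Artifact instances evolve concurrently by interleaving: an event triggers a transition of an instance that is in the source state and not running an activity (or an initial transition) when its condition holds; its activity diagram is then executed with the usual token semantics, and ends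 at a final node when the instance is in the target state. A task can be executed, for some values of its input parameters, when its precondition holds; it leads to any legal information base that has the same read-only part, satisfies the postcondition, and is obtained by an inclusion-minimal set of insertions and deletions of facts. *Artifact termination* is the property $$\nu Z.\Big(\bigwedge_{A\text{ artifact}} \forall x.\,A(x)\rightarrow \mu Y.\,t_A(x)\vee (A(x)\wedge\langle -\rangle Y)\Big)\wedge[-]Z$$ evaluated at the initial state of the resulting transition system. -/

import Mathlib

namespace BAUML

/-!
All names (of classes, associations, attributes, variables, parameters, events), all object
identifiers and all data values are natural numbers. Data values are only ever compared for
equality. Classes are `0, …, numClasses - 1`; associations, attributes, events and activity-diagram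
nodes and edges are referred to by their position in the corresponding list.
-/

/-! ### Class diagrams -/

/-- A multiplicity `lower..upper`; `upper = none` stands for `*`. -/
structure Multiplicity where
  lower : ℕ
  upper : Option ℕ

/-- A binary association. `imMult` is attached to the image role (it bounds the number of image
objects linked to one domain object), `domMult` is attached to the domain role. -/
structure Assoc where
  dom : ℕ
  im : ℕ
  domMult : Multiplicity
  imMult : Multiplicity

/-- A single-valued (string) attribute, of multiplicity `1..1` or `0..1`. -/
structure Attr where
  owner : ℕ
  required : Bool

/-- A UML class diagram, with its partition into a read-only part (listed) and a read-write part
(everything else). `isa` lists the pairs (direct subclass, direct superclass). -/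
structure ClassDiagram where
  numClasses : ℕ
  isa : List (ℕ × ℕ)
  assocs : List Assoc
  attrs : List Attr
  roClasses : List ℕ
  roAssocs : List ℕ

/-- `M.Sub c d`: `c = d`, or `c` is a direct or indirect subclass of `d`. -/
def ClassDiagram.Sub (M : ClassDiagram) : ℕ → ℕ → Prop :=
  Relation.ReflTransGen (fun c d => (c, d) ∈ M.isa)

/-- `c` has no proper subclass. -/
def ClassDiagram.IsLeaf (M : ClassDiagram) (c : ℕ) : Prop :=
  ∀ d, (d, c) ∉ M.isa

/-- The attribute `a` belongs to a read-only class. -/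
def ClassDiagram.ROAttr (M : ClassDiagram) (a : ℕ) : Prop :=
  ∃ d, M.attrs[a]? = some d ∧ d.owner ∈ M.roClasses

/-! ### Information bases -/

/-- The facts an information base consists of: `inst o c` says that `c` is the direct (most
specific) class of the object `o`; `link r o o'` that `(o, o')` is in the association `r`;
`val a o v` that the attribute `a` of `o` has the value `v`. -/
inductive Fact
  | inst (o c : ℕ)
  | link (r o o' : ℕ)
  | val (a o v : ℕ)
  deriving DecidableEq

/-- An information base. -/
abbrev InfoBase := Finset Fact

/-- The object `o` exists in `I`. -/
def InfoBase.Exists (I : InfoBase) (o : ℕ) : Prop := ∃ c, Fact.inst o c ∈ I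

/-- `o` is an instance of `c` in `I` (directly, or through a subclass). -/
def ClassDiagram.HasType (M : ClassDiagram) (I : InfoBase) (o c : ℕ) : Prop :=
  ∃ d, Fact.inst o d ∈ I ∧ M.Sub d c

/-- Facts about the read-only part of the diagram. -/
def ClassDiagram.ROFact (M : ClassDiagram) : Fact → Prop
  | .inst _ c => c ∈ M.roClasses
  | .link r _ _ => r ∈ M.roAssocs
  | .val a _ _ => M.ROAttr a

/-- The number `n` is allowed by the multiplicity. -/
def Multiplicity.Allows (m : Multiplicity) (n : ℕ) : Prop :=
  m.lower ≤ n ∧ ∀ u, m.upper = some u → n ≤ u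

/-- `I` is an instance of the class diagram: every object has a single direct class, links and
attribute values are well typed, multiplicities are respected. -/
structure ClassDiagram.IsInstance (M : ClassDiagram) (I : InfoBase) : Prop where
  inst_class : ∀ o c, Fact.inst o c ∈ I → c < M.numClasses
  inst_unique : ∀ o c d, Fact.inst o c ∈ I → Fact.inst o d ∈ I → c = d
  link_typed : ∀ r o o', Fact.link r o o' ∈ I →
    ∃ a, M.assocs[r]? = some a ∧ M.HasType I o a.dom ∧ M.HasType I o' a.im
  im_mult : ∀ (r : ℕ) (a : Assoc) (o : ℕ), M.assocs[r]? = some a → M.HasType I o a.dom →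
    a.imMult.Allows (Set.ncard {o' | Fact.link r o o' ∈ I})
  dom_mult : ∀ (r : ℕ) (a : Assoc) (o' : ℕ), M.assocs[r]? = some a → M.HasType I o' a.im →
    a.domMult.Allows (Set.ncard {o | Fact.link r o o' ∈ I})
  val_typed : ∀ a o v, Fact.val a o v ∈ I → ∃ d, M.attrs[a]? = some d ∧ M.HasType I o d.owner
  val_unique : ∀ a o v w, Fact.val a o v ∈ I → Fact.val a o w ∈ I → v = w
  val_required : ∀ (a : ℕ) (d : Attr) (o : ℕ), M.attrs[a]? = some d → d.required = true → M.HasType I o d.owner →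
    ∃ v, Fact.val a o v ∈ I

/-! ### OCL -/

/-- An association end: the image role of `assoc` if `toIm`, else its domain role. -/
structure Role where
  assoc : ℕ
  toIm : Bool

/-- One navigation step `.r` or `.r@pre`. -/
structure NavStep where
  role : Role
  atPre : Bool

/-- The start of a path: a variable, or `C.allInstances()` (possibly `@pre`). -/
inductive Source
  | var (x : ℕ)
  | allInstances (c : ℕ) (atPre : Bool)

/-- A path `source.r₁ ⋯ rₙ`, denoting a set of objects. -/
structure Path where
  source : Source
  steps : List NavStep

/-- Expressions denoting sets of data values: a constant, an input parameter of the operation, or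
a path that ends in an attribute (possibly `@pre`). -/
inductive ValExpr
  | const (v : ℕ)
  | param (i : ℕ)
  | attr (p : Path) (a : ℕ) (atPre : Bool)

/-- OCL expressions. Equality of (collections of) objects or values is inclusion in both
directions; `select` and `let` are expressible with the quantifiers. -/
inductive OCL
  | tt
  | isEmpty (p : Path)
  | includesAll (p q : Path)
  | valIncludesAll (s t : ValExpr)
  | oclIsNew (x : ℕ)
  | oclIsTypeOf (x c : ℕ)
  | oclIsKindOf (x c : ℕ)
  | not (φ : OCL)
  | and (φ ψ : OCL)
  | or (φ ψ : OCL)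
  | exists_ (p : Path) (x : ℕ) (φ : OCL)
  | forAll (p : Path) (x : ℕ) (φ : OCL)

/-! Expressions are evaluated over a pair of information bases: `I₀` (the state before the
operation, addressed by `@pre` and `oclIsNew`) and `I` (the current one). Preconditions, conditions
and constraints are evaluated with `I₀ = I`. A variable or parameter without value denotes `∅`. -/

def Source.eval (M : ClassDiagram) (I₀ I : InfoBase) (ρ : ℕ → Option ℕ) : Source → Set ℕ
  | .var x => {o | ρ x = some o}
  | .allInstances c atPre => {o | M.HasType (if atPre then I₀ else I) o c}

/-- The objects reached from `S` by one navigation step. -/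
def NavStep.eval (I₀ I : InfoBase) (S : Set ℕ) (s : NavStep) : Set ℕ :=
  {o' | ∃ o ∈ S, (if s.role.toIm then Fact.link s.role.assoc o o' else Fact.link s.role.assoc o' o)
    ∈ (if s.atPre then I₀ else I)}

def Path.eval (M : ClassDiagram) (I₀ I : InfoBase) (ρ : ℕ → Option ℕ) (p : Path) : Set ℕ :=
  p.steps.foldl (NavStep.eval I₀ I) (p.source.eval M I₀ I ρ)

def ValExpr.eval (M : ClassDiagram) (I₀ I : InfoBase) (π ρ : ℕ → Option ℕ) : ValExpr → Set ℕ
  | .const v => {v}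
  | .param i => {v | π i = some v}
  | .attr p a atPre =>
    {v | ∃ o ∈ p.eval M I₀ I ρ, Fact.val a o v ∈ (if atPre then I₀ else I)}

/-- Truth of an OCL expression; `π` gives the input parameters, `ρ` the object variables. -/
def OCL.Holds (M : ClassDiagram) (I₀ I : InfoBase) (π : ℕ → Option ℕ) :
    OCL → (ℕ → Option ℕ) → Prop
  | .tt, _ => True
  | .isEmpty p, ρ => p.eval M I₀ I ρ = ∅
  | .includesAll p q, ρ => q.eval M I₀ I ρ ⊆ p.eval M I₀ I ρ
  | .valIncludesAll s t, ρ => t.eval M I₀ I π ρ ⊆ s.eval M I₀ I π ρ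
  | .oclIsNew x, ρ => ∃ o, ρ x = some o ∧ I.Exists o ∧ ¬ I₀.Exists o
  | .oclIsTypeOf x c, ρ => ∃ o, ρ x = some o ∧ Fact.inst o c ∈ I
  | .oclIsKindOf x c, ρ => ∃ o, ρ x = some o ∧ M.HasType I o c
  | .not φ, ρ => ¬ φ.Holds M I₀ I π ρ
  | .and φ ψ, ρ => φ.Holds M I₀ I π ρ ∧ ψ.Holds M I₀ I π ρ
  | .or φ ψ, ρ => φ.Holds M I₀ I π ρ ∨ ψ.Holds M I₀ I π ρ
  | .exists_ p x φ, ρ => ∃ o ∈ p.eval M I₀ I ρ, φ.Holds M I₀ I π (Function.update ρ x (some o))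
  | .forAll p x φ, ρ => ∀ o ∈ p.eval M I₀ I ρ, φ.Holds M I₀ I π (Function.update ρ x (some o))

/-! Well-formedness of expressions: names exist, variables are in scope, `@pre` and `oclIsNew`
occur only in postconditions (`post`), input parameters only in operations (`op`). -/

def Source.Ok (M : ClassDiagram) (post : Bool) (scope : List ℕ) : Source → Prop
  | .var x => x ∈ scope
  | .allInstances c atPre => c < M.numClasses ∧ (atPre = true → post = true)

def Path.Ok (M : ClassDiagram) (post : Bool) (scope : List ℕ) (p : Path) : Prop :=
  p.source.Ok M post scope ∧
    ∀ s ∈ p.steps, s.role.assoc < M.assocs.length ∧ (s.atPre = true → post = true)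

def ValExpr.Ok (M : ClassDiagram) (op post : Bool) (scope : List ℕ) : ValExpr → Prop
  | .const _ => True
  | .param _ => op = true
  | .attr p a atPre => p.Ok M post scope ∧ a < M.attrs.length ∧ (atPre = true → post = true)

def OCL.Ok (M : ClassDiagram) (op post : Bool) : OCL → List ℕ → Prop
  | .tt, _ => True
  | .isEmpty p, sc => p.Ok M post sc
  | .includesAll p q, sc => p.Ok M post sc ∧ q.Ok M post sc
  | .valIncludesAll s t, sc => s.Ok M op post sc ∧ t.Ok M op post sc
  | .oclIsNew x, sc => x ∈ sc ∧ post = true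
  | .oclIsTypeOf x c, sc => x ∈ sc ∧ c < M.numClasses
  | .oclIsKindOf x c, sc => x ∈ sc ∧ c < M.numClasses
  | .not φ, sc => φ.Ok M op post sc
  | .and φ ψ, sc => φ.Ok M op post sc ∧ ψ.Ok M op post sc
  | .or φ ψ, sc => φ.Ok M op post sc ∧ ψ.Ok M op post sc
  | .exists_ p x φ, sc => p.Ok M post sc ∧ φ.Ok M op post (x :: sc)
  | .forAll p x φ, sc => p.Ok M post sc ∧ φ.Ok M op post (x :: sc)

/-! Navigational expressions: every path starts from a variable (the artifact instance or a
variable of the expression), or uses only read-only names. -/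

def Path.Navigational (M : ClassDiagram) (p : Path) : Prop :=
  match p.source with
  | .var _ => True
  | .allInstances c _ => c ∈ M.roClasses ∧ ∀ s ∈ p.steps, s.role.assoc ∈ M.roAssocs

def ValExpr.Navigational (M : ClassDiagram) : ValExpr → Prop
  | .const _ => True
  | .param _ => True
  | .attr p a _ =>
    match p.source with
    | .var _ => True
    | .allInstances _ _ => p.Navigational M ∧ M.ROAttr a

def OCL.Navigational (M : ClassDiagram) : OCL → Prop
  | .tt => True
  | .isEmpty p => p.Navigational M
  | .includesAll p q => p.Navigational M ∧ q.Navigational M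
  | .valIncludesAll s t => s.Navigational M ∧ t.Navigational M
  | .oclIsNew _ => True
  | .oclIsTypeOf _ _ => True
  | .oclIsKindOf _ _ => True
  | .not φ => φ.Navigational M
  | .and φ ψ => φ.Navigational M ∧ ψ.Navigational M
  | .or φ ψ => φ.Navigational M ∧ ψ.Navigational M
  | .exists_ p _ φ => p.Navigational M ∧ φ.Navigational M
  | .forAll p _ φ => p.Navigational M ∧ φ.Navigational M

/-! The expression mentions the role `r`. -/

def Path.Mentions (r : Role) (p : Path) : Prop := ∃ s ∈ p.steps, s.role = r

def ValExpr.Mentions (r : Role) : ValExpr → Prop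
  | .const _ => False
  | .param _ => False
  | .attr p _ _ => p.Mentions r

def OCL.Mentions (r : Role) : OCL → Prop
  | .tt => False
  | .isEmpty p => p.Mentions r
  | .includesAll p q => p.Mentions r ∨ q.Mentions r
  | .valIncludesAll s t => s.Mentions r ∨ t.Mentions r
  | .oclIsNew _ => False
  | .oclIsTypeOf _ _ => False
  | .oclIsKindOf _ _ => False
  | .not φ => φ.Mentions r
  | .and φ ψ => φ.Mentions r ∨ ψ.Mentions r
  | .or φ ψ => φ.Mentions r ∨ ψ.Mentions r
  | .exists_ p _ φ => p.Mentions r ∨ φ.Mentions r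
  | .forAll p _ φ => p.Mentions r ∨ φ.Mentions r

/-! ### Tasks, activity diagrams, state transition diagrams, models -/

/-- An atomic task with its operation contract. Variable `0` is the artifact instance taken in
input. A task with `creates` is an `init` operation: it takes no artifact instance in input but
returns a new one, and variable `0` in its postcondition is `result`. -/
structure Task where
  creates : Bool
  pre : OCL
  post : OCL

inductive Node
  | initial
  | final
  | action (t : Task)
  | decision
  | merge
  | fork
  | join

/-- A control-flow edge; the guard is used on the edges that leave a decision node. -/
structure Edge where
  src : ℕ
  tgt : ℕ
  guard : OCL

structure Activity where
  nodes : List Node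
  edges : List Edge

/-- A transition of a state transition diagram; `source = none` for an initial transition. -/
structure Transition where
  source : Option ℕ
  event : ℕ
  cond : OCL
  target : ℕ

/-- An artifact class with its state transition diagram: the states are the leaves of the hierarchy
below `cls`, the events are the positions in `activities`, which gives the activity diagram of each
event. `final` is the proper termination state. -/
structure Artifact where
  cls : ℕ
  initial : ℕ
  final : ℕ
  transitions : List Transition
  activities : List Activity

structure Model where
  diagram : ClassDiagram
  constraints : List OCL
  artifacts : List Artifact

/-- The (positions of) edges that enter node `n`. -/
def Activity.inEdges (a : Activity) (n : ℕ) : List ℕ :=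
  (List.range a.edges.length).filter fun e => (a.edges[e]?.map Edge.tgt) = some n

/-- The (positions of) edges that leave node `n`. -/
def Activity.outEdges (a : Activity) (n : ℕ) : List ℕ :=
  (List.range a.edges.length).filter fun e => (a.edges[e]?.map Edge.src) = some n

def Activity.HasTask (a : Activity) (t : Task) : Prop := Node.action t ∈ a.nodes

/-- Restrictions on the numbers of edges that enter and leave a node. -/
def Node.DegreesOk (ins outs : List ℕ) : Node → Prop
  | .initial => ins = [] ∧ outs ≠ []
  | .final => ins ≠ [] ∧ outs = []
  | .action _ => ins ≠ []
  | .decision => ins.length = 1 ∧ outs ≠ []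
  | .merge => ins ≠ [] ∧ outs.length = 1
  | .fork => ins.length = 1 ∧ outs ≠ []
  | .join => ins ≠ [] ∧ outs.length = 1

structure Activity.WellFormed (M : ClassDiagram) (a : Activity) : Prop where
  edge_ends : ∀ e ∈ a.edges, e.src < a.nodes.length ∧ e.tgt < a.nodes.length
  initial_unique : ∃! n : ℕ, a.nodes[n]? = some Node.initial
  degrees : ∀ (n : ℕ) (k : Node), a.nodes[n]? = some k → k.DegreesOk (a.inEdges n) (a.outEdges n)
  guards : ∀ e ∈ a.edges, a.nodes[e.src]? ≠ some Node.decision → e.guard = OCL.tt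
  guard_ok : ∀ e ∈ a.edges, e.guard.Ok M false false [0]
  task_ok : ∀ t, a.HasTask t →
    t.pre.Ok M true false (if t.creates then [] else [0]) ∧ t.post.Ok M true true [0]

/-- `c` is a state of the artifact: a leaf of the hierarchy with top class `A.cls`. -/
def Artifact.IsState (M : ClassDiagram) (A : Artifact) (c : ℕ) : Prop :=
  M.Sub c A.cls ∧ M.IsLeaf c

structure Artifact.WellFormed (M : ClassDiagram) (A : Artifact) : Prop where
  cls_valid : A.cls < M.numClasses
  cls_top : ∀ d, (A.cls, d) ∉ M.isa
  cls_rw : ∀ c, M.Sub c A.cls → c ∉ M.roClasses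
  initial_state : A.IsState M A.initial
  final_state : A.IsState M A.final
  trans_states : ∀ t ∈ A.transitions, A.IsState M t.target ∧
    (∀ v, t.source = some v → A.IsState M v) ∧ (t.source = none → t.target = A.initial)
  trans_event : ∀ t ∈ A.transitions, t.event < A.activities.length
  trans_cond : ∀ t ∈ A.transitions, t.cond.Ok M false false (if t.source = none then [] else [0])
  trans_creates : ∀ t ∈ A.transitions, t.source ≠ none →
    ∀ P, A.activities[t.event]? = some P → ∀ k, P.HasTask k → k.creates = false
  activity_ok : ∀ P ∈ A.activities, P.WellFormed M

structure Model.WellFormed (B : Model) : Prop where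
  isa_valid : ∀ p ∈ B.diagram.isa, p.1 < B.diagram.numClasses ∧ p.2 < B.diagram.numClasses
  isa_acyclic : ∀ c, ¬ Relation.TransGen (fun c d => (c, d) ∈ B.diagram.isa) c c
  assoc_valid : ∀ a ∈ B.diagram.assocs, a.dom < B.diagram.numClasses ∧ a.im < B.diagram.numClasses
  attr_valid : ∀ a ∈ B.diagram.attrs, a.owner < B.diagram.numClasses
  constraint_ok : ∀ φ ∈ B.constraints, φ.Ok B.diagram false false []
  artifact_ok : ∀ A ∈ B.artifacts, A.WellFormed B.diagram
  artifact_disjoint : ∀ (i j : ℕ) (A A' : Artifact), B.artifacts[i]? = some A →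
    B.artifacts[j]? = some A' →
    ∀ c, B.diagram.Sub c A.cls → B.diagram.Sub c A'.cls → i = j

/-! ### Navigational and unidirectional models -/

/-- `t` is a task of the model. -/
def Model.HasTask (B : Model) (t : Task) : Prop :=
  ∃ A ∈ B.artifacts, ∃ P ∈ A.activities, P.HasTask t

/-- `φ` is a condition of the model: on a transition, or a guard in an activity diagram. -/
def Model.HasCond (B : Model) (φ : OCL) : Prop :=
  ∃ A ∈ B.artifacts, (∃ t ∈ A.transitions, t.cond = φ) ∨
    ∃ P ∈ A.activities, ∃ e ∈ P.edges, e.guard = φ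

/-- `φ` is one of the OCL expressions of the model. -/
def Model.HasExpr (B : Model) (φ : OCL) : Prop :=
  φ ∈ B.constraints ∨ B.HasCond φ ∨ ∃ t, B.HasTask t ∧ (t.pre = φ ∨ t.post = φ)

/-- All conditions, and the contracts of all tasks except the `init` operations, are
navigational. -/
def Model.Navigational (B : Model) : Prop :=
  (∀ t, B.HasTask t → t.creates = false →
    t.pre.Navigational B.diagram ∧ t.post.Navigational B.diagram) ∧
  ∀ φ, B.HasCond φ → φ.Navigational B.diagram

/-- A target role: some OCL expression of the model mentions it. -/
def Model.Target (B : Model) (r : Role) : Prop := ∃ φ, B.HasExpr φ ∧ φ.Mentions r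

/-- Some association connects `c` and `d`, and its role attached to `d` is a target role. -/
def Model.DependsStep (B : Model) (c d : ℕ) : Prop :=
  ∃ r a, B.diagram.assocs[r]? = some a ∧
    ((a.dom = c ∧ a.im = d ∧ B.Target ⟨r, true⟩) ∨ (a.im = c ∧ a.dom = d ∧ B.Target ⟨r, false⟩))

/-- `B.DependsOn d c`: the class `d` depends on the class `c`. -/
def Model.DependsOn (B : Model) (d c : ℕ) : Prop := Relation.TransGen B.DependsStep c d

/-- The model is navigational and no read-write class depends on itself or on one of its
super- or subclasses. -/
def Model.Unidirectional (B : Model) : Prop :=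
  B.Navigational ∧ ∀ c, c < B.diagram.numClasses → c ∉ B.diagram.roClasses →
    ∀ d, (B.diagram.Sub c d ∨ B.diagram.Sub d c) → ¬ B.DependsOn c d

/-! ### Execution semantics -/

/-- No parameters, respectively no variables, have a value. -/
def noVal : ℕ → Option ℕ := fun _ => none

/-- The variable assignment in which variable `0` is the artifact instance in scope, if any. -/
def selfEnv (self : Option ℕ) : ℕ → Option ℕ := Function.update noVal 0 self

/-- Truth of a condition in `I`, for the artifact instance `self` in scope. -/
def OCL.CondHolds (M : ClassDiagram) (I : InfoBase) (self : Option ℕ) (φ : OCL) : Prop :=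
  φ.Holds M I I noVal (selfEnv self)

/-- Legal information bases: instances of the class diagram in which every artifact instance is in
one of its states and all OCL constraints hold. -/
def Model.Legal (B : Model) (I : InfoBase) : Prop :=
  B.diagram.IsInstance I ∧
  (∀ A ∈ B.artifacts, ∀ o c, Fact.inst o c ∈ I → B.diagram.Sub c A.cls → A.IsState B.diagram c) ∧
  ∀ φ ∈ B.constraints, φ.CondHolds B.diagram I none

/-- `J` is a legal information base with the same read-only part as `I`, and the postcondition of
`t` holds for the passage from `I` to `J`; `self'` is the artifact instance in input or, if `t`
creates an instance of `A`, the new instance. -/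
def Task.Admissible (B : Model) (A : Artifact) (t : Task) (π : ℕ → ℕ) (self' : Option ℕ)
    (I J : InfoBase) : Prop :=
  B.Legal J ∧
  (∀ f, B.diagram.ROFact f → (f ∈ I ↔ f ∈ J)) ∧
  t.post.Holds B.diagram I J (fun i => some (π i)) (selfEnv self') ∧
  (t.creates = true → ∃ o, self' = some o ∧ ¬ I.Exists o ∧ B.diagram.HasType J o A.cls)

/-- Execution of a task, with input parameters `π`: the artifact instance in input (if any) is an
instance of `A`, the precondition holds in `I`, and `J` is
obtained from `I` by a minimal (with respect to inclusion) set of insertions and deletions of facts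
that makes the postcondition true; that is, whatever the postcondition does not require to change
stays as it is. -/
def Task.Exec (B : Model) (A : Artifact) (t : Task) (self self' : Option ℕ)
    (I J : InfoBase) : Prop :=
  (if t.creates = true then self = none else self' = self) ∧
  (∀ o, self = some o → B.diagram.HasType I o A.cls) ∧
  ∃ π : ℕ → ℕ,
    t.pre.Holds B.diagram I I (fun i => some (π i)) (selfEnv self) ∧
    t.Admissible B A π self' I J ∧
    ∀ K, t.Admissible B A π self' I K → symmDiff I K ⊆ symmDiff I J → K = J

/-- A running activity diagram: the artifact type and the transition being taken (as positions in
the lists), the artifact instance (`none` before it has been created), and the tokens, which lie on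
the edges of the activity diagram. -/
structure Proc where
  art : ℕ
  trans : ℕ
  self : Option ℕ
  tokens : Multiset ℕ

/-- A state of the system. -/
structure Config where
  ib : InfoBase
  procs : Multiset Proc

/-- Node `n`, of kind `k`, consumes the tokens `c`. -/
def Node.Consumes (P : Activity) (n : ℕ) (c : Multiset ℕ) : Node → Prop
  | .initial => False
  | .final => False
  | .merge => ∃ e ∈ P.inEdges n, c = {e}
  | _ => c = (P.inEdges n : Multiset ℕ)

/-- Node `n`, of kind `k`, produces the tokens `c`. -/
def Node.Produces (M : ClassDiagram) (P : Activity) (I : InfoBase) (self : Option ℕ) (n : ℕ)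
    (c : Multiset ℕ) : Node → Prop
  | .decision => ∃ e ∈ P.outEdges n, c = {e} ∧
      ∃ g, P.edges[e]? = some g ∧ g.guard.CondHolds M I self
  | _ => c = (P.outEdges n : Multiset ℕ)

/-- The effect of a node on the information base and the artifact instance in scope. -/
def Node.Effect (B : Model) (A : Artifact) (self self' : Option ℕ) (I J : InfoBase) : Node → Prop
  | .action t => t.Exec B A self self' I J
  | _ => self' = self ∧ J = I

/-- Steps of the system: artifact instances evolve concurrently, by interleaving. -/
inductive Model.Step (B : Model) : Config → Config → Prop
  /-- An event triggers a transition: an initial one, or one that leaves the current state of an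
  artifact instance which is not running an activity. -/
  | start (I : InfoBase) (ps : Multiset Proc) (i k : ℕ) (A : Artifact) (t : Transition)
      (P : Activity) (n : ℕ) (self : Option ℕ)
      (hA : B.artifacts[i]? = some A) (ht : A.transitions[k]? = some t)
      (hP : A.activities[t.event]? = some P) (hn : P.nodes[n]? = some Node.initial)
      (hself : (t.source = none ∧ self = none) ∨
        ∃ v o, t.source = some v ∧ self = some o ∧ Fact.inst o v ∈ I ∧ ∀ q ∈ ps, q.self ≠ some o)
      (hcond : t.cond.CondHolds B.diagram I self) :
      Model.Step B ⟨I, ps⟩ ⟨I, ⟨i, k, self, (P.outEdges n : Multiset ℕ)⟩ ::ₘ ps⟩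
  /-- A node of a running activity diagram fires; an artifact instance runs at most one activity. -/
  | fire (I J : InfoBase) (ps : Multiset Proc) (i k : ℕ) (A : Artifact) (t : Transition)
      (P : Activity) (n : ℕ) (nd : Node) (self self' : Option ℕ) (rest c d : Multiset ℕ)
      (hA : B.artifacts[i]? = some A) (ht : A.transitions[k]? = some t)
      (hP : A.activities[t.event]? = some P) (hn : P.nodes[n]? = some nd)
      (hc : nd.Consumes P n c) (hd : nd.Produces B.diagram P I self n d)
      (he : nd.Effect B A self self' I J) (hps : ∀ q ∈ ps, ∀ o, self' = some o → q.self ≠ some o) :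
      Model.Step B ⟨I, ⟨i, k, self, rest + c⟩ ::ₘ ps⟩ ⟨J, ⟨i, k, self', rest + d⟩ ::ₘ ps⟩
  /-- A running activity diagram ends when a token reaches a final node and the artifact instance
  is in the target state of the transition. -/
  | finish (I : InfoBase) (ps : Multiset Proc) (i k : ℕ) (A : Artifact) (t : Transition)
      (P : Activity) (n o e : ℕ) (tokens : Multiset ℕ)
      (hA : B.artifacts[i]? = some A) (ht : A.transitions[k]? = some t)
      (hP : A.activities[t.event]? = some P) (hn : P.nodes[n]? = some Node.final)
      (he : e ∈ P.inEdges n) (htok : e ∈ tokens) (htarget : Fact.inst o t.target ∈ I) :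
      Model.Step B ⟨I, ⟨i, k, some o, tokens⟩ ::ₘ ps⟩ ⟨I, ps⟩

/-! ### Artifact termination -/

/-- `⟨-⟩Y`. -/
def Model.Diamond (B : Model) (Y : Set Config) : Set Config := {s | ∃ s', B.Step s s' ∧ s' ∈ Y}

/-- `[-]Z`. -/
def Model.Box (B : Model) (Z : Set Config) : Set Config := {s | ∀ s', B.Step s s' → s' ∈ Z}

/-- The operator `Y ↦ t_A(x) ∨ (A(x) ∧ ⟨-⟩Y)`, with `t_A` the termination state of `A`. -/
def Model.reachOp (B : Model) (A : Artifact) (x : ℕ) : Set Config →o Set Config where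
  toFun Y := {s | B.diagram.HasType s.ib x A.final ∨
    (B.diagram.HasType s.ib x A.cls ∧ s ∈ B.Diamond Y)}
  monotone' := by
    rintro Y Y' h s (hs | ⟨hs, s', hst, hs'⟩)
    · exact Or.inl hs
    · exact Or.inr ⟨hs, s', hst, h hs'⟩

/-- The operator `Z ↦ (⋀_A ∀x. A(x) → μY. t_A(x) ∨ (A(x) ∧ ⟨-⟩Y)) ∧ [-]Z`. -/
def Model.terminationOp (B : Model) : Set Config →o Set Config where
  toFun Z := {s | (∀ A ∈ B.artifacts, ∀ x, B.diagram.HasType s.ib x A.cls →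
    s ∈ OrderHom.lfp (B.reachOp A x)) ∧ s ∈ B.Box Z}
  monotone' := fun _ _ h _ hs => ⟨hs.1, fun s' hst => h (hs.2 s' hst)⟩

/-- The artifact termination property `νZ. (⋀_A ∀x. A(x) → μY. t_A(x) ∨ (A(x) ∧ ⟨-⟩Y)) ∧ [-]Z`
holds in the initial state given by the initial information base `D` (nothing is running). -/
def Model.Terminates (B : Model) (D : InfoBase) : Prop :=
  (⟨D, 0⟩ : Config) ∈ OrderHom.gfp B.terminationOp

/-! ### Codes of models

An injective numbering of models, built from Mathlib's standard codings of pairs, options and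
lists, so that a model can be the input of a computable function. -/

open Encodable

def Multiplicity.code (m : Multiplicity) : ℕ := encode (m.lower, m.upper)

def Assoc.code (a : Assoc) : ℕ := encode (a.dom, a.im, a.domMult.code, a.imMult.code)

def Attr.code (a : Attr) : ℕ := encode (a.owner, a.required)

def ClassDiagram.code (M : ClassDiagram) : ℕ :=
  encode (M.numClasses, M.isa, M.assocs.map Assoc.code, M.attrs.map Attr.code, M.roClasses,
    M.roAssocs)

def NavStep.code (s : NavStep) : ℕ := encode (s.role.assoc, s.role.toIm, s.atPre)

def Source.code : Source → ℕ
  | .var x => encode (0, x)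
  | .allInstances c b => encode (1, encode (c, b))

def Path.code (p : Path) : ℕ := encode (p.source.code, p.steps.map NavStep.code)

def ValExpr.code : ValExpr → ℕ
  | .const v => encode (0, v)
  | .param i => encode (1, i)
  | .attr p a b => encode (2, encode (p.code, a, b))

def OCL.code : OCL → ℕ
  | .tt => encode (0, 0)
  | .isEmpty p => encode (1, p.code)
  | .includesAll p q => encode (2, encode (p.code, q.code))
  | .valIncludesAll s t => encode (3, encode (s.code, t.code))
  | .oclIsNew x => encode (4, x)
  | .oclIsTypeOf x c => encode (5, encode (x, c))
  | .oclIsKindOf x c => encode (6, encode (x, c))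
  | .not φ => encode (7, φ.code)
  | .and φ ψ => encode (8, encode (φ.code, ψ.code))
  | .or φ ψ => encode (9, encode (φ.code, ψ.code))
  | .exists_ p x φ => encode (10, encode (p.code, x, φ.code))
  | .forAll p x φ => encode (11, encode (p.code, x, φ.code))

def Task.code (t : Task) : ℕ := encode (t.creates, t.pre.code, t.post.code)

def Node.code : Node → ℕ
  | .initial => encode (0, 0)
  | .final => encode (1, 0)
  | .action t => encode (2, t.code)
  | .decision => encode (3, 0)
  | .merge => encode (4, 0)
  | .fork => encode (5, 0)
  | .join => encode (6, 0)

def Edge.code (e : Edge) : ℕ := encode (e.src, e.tgt, e.guard.code)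

def Activity.code (a : Activity) : ℕ := encode (a.nodes.map Node.code, a.edges.map Edge.code)

def Transition.code (t : Transition) : ℕ := encode (t.source, t.event, t.cond.code, t.target)

def Artifact.code (A : Artifact) : ℕ :=
  encode (A.cls, A.initial, A.final, A.transitions.map Transition.code,
    A.activities.map Activity.code)

def Model.code (B : Model) : ℕ :=
  encode (B.diagram.code, B.constraints.map OCL.code, B.artifacts.map Artifact.code)

theorem Multiplicity.code_injective : Function.Injective Multiplicity.code := by
  rintro ⟨⟩ ⟨⟩ h
  have h := encode_injective h
  simp_all

theorem Assoc.code_injective : Function.Injective Assoc.code := by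
  rintro ⟨⟩ ⟨⟩ h
  have h := encode_injective h
  simp_all [Multiplicity.code_injective.eq_iff]

theorem Attr.code_injective : Function.Injective Attr.code := by
  rintro ⟨⟩ ⟨⟩ h
  have h := encode_injective h
  simp_all

theorem ClassDiagram.code_injective : Function.Injective ClassDiagram.code := by
  rintro ⟨⟩ ⟨⟩ h
  have h := encode_injective h
  simp_all [(List.map_injective_iff.2 Assoc.code_injective).eq_iff,
    (List.map_injective_iff.2 Attr.code_injective).eq_iff]

theorem NavStep.code_injective : Function.Injective NavStep.code := by
  rintro ⟨⟨⟩, _⟩ ⟨⟨⟩, _⟩ h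
  have h := encode_injective h
  simp_all

theorem Source.code_injective : Function.Injective Source.code := by
  rintro (_ | _) (_ | _) h <;> have h := encode_injective h <;> simp_all

theorem Path.code_injective : Function.Injective Path.code := by
  rintro ⟨⟩ ⟨⟩ h
  have h := encode_injective h
  simp_all [Source.code_injective.eq_iff,
    (List.map_injective_iff.2 NavStep.code_injective).eq_iff]

theorem ValExpr.code_injective : Function.Injective ValExpr.code := by
  rintro (_ | _ | _) (_ | _ | _) h <;> have h := encode_injective h <;>
    simp_all [Path.code_injective.eq_iff]

theorem OCL.code_injective : Function.Injective OCL.code := by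
  intro φ
  induction φ <;> rintro (_ | _ | _ | _ | _ | _ | _ | _ | _ | _ | _ | _) h <;>
    have h := encode_injective h <;>
    simp only [Prod.mk.injEq, encode_inj, Path.code_injective.eq_iff,
      ValExpr.code_injective.eq_iff] at h <;> grind

theorem Task.code_injective : Function.Injective Task.code := by
  rintro ⟨⟩ ⟨⟩ h
  have h := encode_injective h
  simp_all [OCL.code_injective.eq_iff]

theorem Node.code_injective : Function.Injective Node.code := by
  rintro (_ | _ | _ | _ | _ | _ | _) (_ | _ | _ | _ | _ | _ | _) h <;>
    have h := encode_injective h <;> simp_all [Task.code_injective.eq_iff]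

theorem Edge.code_injective : Function.Injective Edge.code := by
  rintro ⟨⟩ ⟨⟩ h
  have h := encode_injective h
  simp_all [OCL.code_injective.eq_iff]

theorem Activity.code_injective : Function.Injective Activity.code := by
  rintro ⟨⟩ ⟨⟩ h
  have h := encode_injective h
  simp_all [(List.map_injective_iff.2 Node.code_injective).eq_iff,
    (List.map_injective_iff.2 Edge.code_injective).eq_iff]

theorem Transition.code_injective : Function.Injective Transition.code := by
  rintro ⟨⟩ ⟨⟩ h
  have h := encode_injective h
  simp_all [OCL.code_injective.eq_iff]

theorem Artifact.code_injective : Function.Injective Artifact.code := by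
  rintro ⟨⟩ ⟨⟩ h
  have h := encode_injective h
  simp_all [(List.map_injective_iff.2 Transition.code_injective).eq_iff,
    (List.map_injective_iff.2 Activity.code_injective).eq_iff]

theorem Model.code_injective : Function.Injective Model.code := by
  rintro ⟨⟩ ⟨⟩ h
  have h := encode_injective h
  simp_all [ClassDiagram.code_injective.eq_iff,
    (List.map_injective_iff.2 OCL.code_injective).eq_iff,
    (List.map_injective_iff.2 Artifact.code_injective).eq_iff]

end BAUML

/-! The halting problem reduces to artifact termination, because unidirectionality restricts tasks
and conditions but leaves the constraints free to quantify over whole classes, and because a task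
may insert arbitrarily much data as long as the result is legal and the change minimal.

Fix a partial recursive function with undecidable domain (`exists_code_not_computable_dom`). Its
graph is the least model of a finite Horn program over the natural numbers (`program`), so halting
on `n` means derivability of an atom with first argument `n` (`derivable_program_iff`: the rules are
true in the intended reading, and every halting computation is a derivation).

Derivability has finite certificates: a list of derivation steps together with a strict order in
which premises come before conclusions. Since data values can only be compared for equality, the
order is stored as a class of pairs. On a finite base a transitive irreflexive relation is
well-founded, so values can be read as numbers along the successor steps and a certificate yields a
genuine derivation (`Certificate.derivable`). Conversely a derivation yields a certificate stored in
an information base (`exists_legal_of_derivable`).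

The model `certModel` has one artifact with an initial and a termination state, plus two
attribute-only classes for steps and pairs. Its constraints say that an instance in the termination
state may exist only next to a certificate. There are no associations and the two task contracts
contain no paths, so the model is trivially unidirectional. If no certificate exists, a created
instance can never terminate. If one exists, the completing task can always be executed: some legal
result exists, hence a minimal one. To keep this true in every reachable configuration, an invariant
is needed, whose crucial point is that no task takes an instance out of the termination state
(`inst_final_of_exec`, by minimality of changes). Together these give `certModel_terminates_iff`.
The argument `n` enters the model only through constants and the number of constraints, so its code
is primitive recursive in `n`. -/

namespace BAUML

/-! ### Horn rules -/

/-- An atom of a Horn program with ternary predicates. In a rule the arguments are variables, in a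
ground atom they are numbers. -/
structure Atom where
  tag : ℕ
  x : ℕ
  y : ℕ
  z : ℕ

/-- The instance of an atom under a valuation of the variables. -/
def Atom.subst (σ : ℕ → ℕ) (a : Atom) : Atom := ⟨a.tag, σ a.x, σ a.y, σ a.z⟩

structure Rule where
  head : Atom
  prems : List Atom

/-- The ground atoms derivable from a Horn program. Predicate `0` is the graph of the successor
function, and variable `0` stands for the number zero. -/
inductive Derivable (P : List Rule) : Atom → Prop
  | succ (x z : ℕ) : Derivable P ⟨0, x, x + 1, z⟩
  | rule (r : Rule) (σ : ℕ → ℕ) (hr : r ∈ P) (h0 : σ 0 = 0)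
      (hp : ∀ a ∈ r.prems, Derivable P (a.subst σ)) : Derivable P (r.head.subst σ)

/-- The variables of the atom are among the variables `0, …, 9`. -/
def Atom.Bounded (a : Atom) : Prop := a.x < 10 ∧ a.y < 10 ∧ a.z < 10

/-- The rule does not derive successor atoms, and its variables are among `0, …, 9`. -/
def Rule.WellFormed (r : Rule) : Prop :=
  r.head.tag ≠ 0 ∧ r.head.Bounded ∧ ∀ a ∈ r.prems, a.Bounded

theorem Rule.wellFormed_mk (a : Atom) (l : List Atom) :
    Rule.WellFormed ⟨a, l⟩ ↔ a.tag ≠ 0 ∧ a.Bounded ∧ ∀ b ∈ l, b.Bounded := Iff.rfl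

/-! ### The Horn program of a partial recursive function -/

section
open Nat.Partrec

/-- Rules for the order (predicate `1`) and for the graph of the pairing function
(predicate `2`). -/
def baseRules : List Rule :=
  [⟨⟨1, 1, 2, 0⟩, [⟨0, 1, 2, 0⟩]⟩,
   ⟨⟨1, 1, 3, 0⟩, [⟨1, 1, 2, 0⟩, ⟨0, 2, 3, 0⟩]⟩,
   ⟨⟨2, 0, 0, 0⟩, []⟩,
   ⟨⟨2, 4, 2, 5⟩, [⟨2, 1, 2, 3⟩, ⟨0, 1, 4, 0⟩, ⟨0, 3, 5, 0⟩, ⟨1, 4, 2, 0⟩]⟩,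
   ⟨⟨2, 2, 0, 5⟩, [⟨2, 1, 2, 3⟩, ⟨0, 1, 2, 0⟩, ⟨0, 3, 5, 0⟩]⟩,
   ⟨⟨2, 1, 4, 5⟩, [⟨2, 1, 2, 3⟩, ⟨1, 2, 1, 0⟩, ⟨0, 2, 4, 0⟩, ⟨0, 3, 5, 0⟩]⟩,
   ⟨⟨2, 0, 4, 5⟩, [⟨2, 1, 1, 3⟩, ⟨0, 1, 4, 0⟩, ⟨0, 3, 5, 0⟩]⟩]

/-- The predicate for the graph of the function with code `c`. -/
def codeTag (c : Code) : ℕ := c.encodeCode + 3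

/-- Rules for the graph of the function with code `c`. -/
def codeRules : Code → List Rule
  | .zero => [⟨⟨codeTag .zero, 1, 0, 0⟩, []⟩]
  | .succ => [⟨⟨codeTag .succ, 1, 2, 0⟩, [⟨0, 1, 2, 0⟩]⟩]
  | .left => [⟨⟨codeTag .left, 3, 1, 0⟩, [⟨2, 1, 2, 3⟩]⟩]
  | .right => [⟨⟨codeTag .right, 3, 2, 0⟩, [⟨2, 1, 2, 3⟩]⟩]
  | .pair f g =>
    ⟨⟨codeTag (.pair f g), 1, 4, 0⟩, [⟨codeTag f, 1, 2, 0⟩, ⟨codeTag g, 1, 3, 0⟩, ⟨2, 2, 3, 4⟩]⟩ ::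
      (codeRules f ++ codeRules g)
  | .comp f g =>
    ⟨⟨codeTag (.comp f g), 1, 3, 0⟩, [⟨codeTag g, 1, 2, 0⟩, ⟨codeTag f, 2, 3, 0⟩]⟩ ::
      (codeRules f ++ codeRules g)
  | .prec f g =>
    ⟨⟨codeTag (.prec f g), 2, 3, 0⟩, [⟨2, 1, 0, 2⟩, ⟨codeTag f, 1, 3, 0⟩]⟩ ::
    ⟨⟨codeTag (.prec f g), 4, 9, 0⟩,
      [⟨2, 1, 3, 4⟩, ⟨0, 2, 3, 0⟩, ⟨2, 1, 2, 5⟩, ⟨codeTag (.prec f g), 5, 6, 0⟩, ⟨2, 2, 6, 7⟩,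
        ⟨2, 1, 7, 8⟩, ⟨codeTag g, 8, 9, 0⟩]⟩ ::
      (codeRules f ++ codeRules g)
  | .rfind' f =>
    ⟨⟨codeTag (.rfind' f), 3, 2, 0⟩, [⟨2, 1, 2, 3⟩, ⟨codeTag f, 3, 0, 0⟩]⟩ ::
    ⟨⟨codeTag (.rfind' f), 3, 8, 0⟩,
      [⟨2, 1, 2, 3⟩, ⟨codeTag f, 3, 5, 0⟩, ⟨0, 4, 5, 0⟩, ⟨0, 2, 6, 0⟩, ⟨2, 1, 6, 7⟩,
        ⟨codeTag (.rfind' f), 7, 8, 0⟩]⟩ ::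
      codeRules f

/-- The Horn program that evaluates the code `c`. -/
def program (c : Code) : List Rule := baseRules ++ codeRules c

theorem program_wellFormed (c : Code) : ∀ r ∈ program c, r.WellFormed := by
  have hb : ∀ r ∈ baseRules, r.WellFormed := by
    simp [baseRules, Rule.WellFormed, Atom.Bounded]
  have hc : ∀ r ∈ codeRules c, r.WellFormed := by
    induction c <;>
      simp only [codeRules, List.forall_mem_cons, List.forall_mem_append, Rule.wellFormed_mk,
        Atom.Bounded, codeTag] at * <;>
      simp_all
  intro r hr
  rcases List.mem_append.1 hr with h | h
  exacts [hb r h, hc r h]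

/-- The intended meaning of ground atoms. -/
def Atom.IsTrue : Atom → Prop
  | ⟨0, x, y, _⟩ => y = x + 1
  | ⟨1, x, y, _⟩ => x < y
  | ⟨2, x, y, z⟩ => z = Nat.pair x y
  | ⟨k + 3, x, y, _⟩ => y ∈ (Code.ofNatCode k).eval x

theorem Atom.isTrue_succ (x y z : ℕ) : Atom.IsTrue ⟨0, x, y, z⟩ ↔ y = x + 1 := Iff.rfl

theorem Atom.isTrue_less (x y z : ℕ) : Atom.IsTrue ⟨1, x, y, z⟩ ↔ x < y := Iff.rfl

theorem Atom.isTrue_pair (x y z : ℕ) : Atom.IsTrue ⟨2, x, y, z⟩ ↔ z = Nat.pair x y := Iff.rfl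

theorem Atom.isTrue_code (c : Code) (x y z : ℕ) :
    Atom.IsTrue ⟨codeTag c, x, y, z⟩ ↔ y ∈ c.eval x := by
  have : Code.ofNatCode c.encodeCode = c := by
    rw [← Code.encodeCode_eq, ← Code.ofNatCode_eq, Denumerable.ofNat_encode]
  simp only [codeTag, Atom.IsTrue, this]

/-- One step of the unbounded search, in the form that the two `rfind'` rules express: "nonzero" is
turned into "has a predecessor `v`", which keeps the rules free of negation. -/
theorem mem_eval_rfind' (f : Code) (a m y : ℕ) :
    y ∈ f.rfind'.eval (Nat.pair a m) ↔ (0 ∈ f.eval (Nat.pair a m) ∧ y = m) ∨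
      ∃ v, v + 1 ∈ f.eval (Nat.pair a m) ∧ y ∈ f.rfind'.eval (Nat.pair a (m + 1)) := by
  -- Here `n` is the number of steps the search advances beyond its starting point `m`.
  have key : ∀ m y, y ∈ f.rfind'.eval (Nat.pair a m) ↔ ∃ n, y = n + m ∧
      0 ∈ f.eval (Nat.pair a (n + m)) ∧ ∀ k < n, ∃ v, v + 1 ∈ f.eval (Nat.pair a (k + m)) := by
    intro m y
    simp only [Code.eval, Nat.unpaired, Nat.unpair_pair, Part.mem_map_iff]
    constructor
    · rintro ⟨n, hn, rfl⟩
      obtain ⟨h, h'⟩ := Nat.mem_rfind.1 hn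
      refine ⟨n, rfl, by simpa using h, fun k hk => ?_⟩
      obtain ⟨v, hv, hv'⟩ := (Part.mem_map_iff _).1 (h' hk)
      have : v ≠ 0 := by simpa using hv'
      exact ⟨v - 1, by rwa [Nat.sub_add_cancel (Nat.pos_of_ne_zero this)]⟩
    · rintro ⟨n, rfl, h, h'⟩
      refine ⟨n, Nat.mem_rfind.2 ⟨by simpa using h, fun {k} hk => ?_⟩, rfl⟩
      obtain ⟨v, hv⟩ := h' k hk
      exact (Part.mem_map_iff _).2 ⟨v + 1, hv, by simp⟩
  rw [key, key]
  constructor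
  · rintro ⟨_ | n, rfl, h, h'⟩
    · exact Or.inl ⟨by simpa using h, by simp⟩
    · obtain ⟨v, hv⟩ := h' 0 (by simp)
      refine Or.inr ⟨v, by simpa using hv, n, by ring, by convert h using 2; ring_nf, fun k hk => ?_⟩
      obtain ⟨w, hw⟩ := h' (k + 1) (by omega)
      exact ⟨w, by convert hw using 2; ring_nf⟩
  · rintro (⟨h, rfl⟩ | ⟨v, hv, n, rfl, h, h'⟩)
    · exact ⟨0, by simp, by simpa using h, by simp⟩
    · refine ⟨n + 1, by ring, by convert h using 2; ring_nf, fun k hk => ?_⟩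
      rcases k with _ | k
      · exact ⟨v, by simpa using hv⟩
      · obtain ⟨w, hw⟩ := h' k (by omega)
        exact ⟨w, by convert hw using 2; ring_nf⟩

/-! ### Soundness of the rules in the natural numbers. -/

theorem baseRules_sound (r : Rule) (hr : r ∈ baseRules) (σ : ℕ → ℕ) (h0 : σ 0 = 0)
    (h : ∀ a ∈ r.prems, (a.subst σ).IsTrue) : (r.head.subst σ).IsTrue := by
  simp only [baseRules, List.mem_cons, List.not_mem_nil, or_false] at hr
  rcases hr with rfl | rfl | rfl | rfl | rfl | rfl | rfl <;>
    simp only [List.forall_mem_cons, Atom.subst, Atom.isTrue_succ,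
      Atom.isTrue_less, Atom.isTrue_pair, h0, Nat.pair] at h ⊢ <;>
    grind

set_option linter.unusedSimpArgs false in
theorem codeRules_sound (c : Code) (r : Rule) (hr : r ∈ codeRules c) (σ : ℕ → ℕ) (h0 : σ 0 = 0)
    (h : ∀ a ∈ r.prems, (a.subst σ).IsTrue) : (r.head.subst σ).IsTrue := by
  induction c with
  | zero =>
    simp only [codeRules, List.mem_cons, List.not_mem_nil, or_false] at hr
    subst hr
    simp [Atom.subst, Atom.isTrue_code, h0, Code.eval, pure, PFun.pure]
  | succ =>
    simp only [codeRules, List.mem_cons, List.not_mem_nil, or_false] at hr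
    subst hr
    simp only [List.forall_mem_cons, Atom.subst, Atom.isTrue_code, Atom.isTrue_succ,
        Atom.isTrue_pair] at h ⊢
    simp [Code.eval, h.1]
  | left =>
    simp only [codeRules, List.mem_cons, List.not_mem_nil, or_false] at hr
    subst hr
    simp only [List.forall_mem_cons, Atom.subst, Atom.isTrue_code, Atom.isTrue_succ,
        Atom.isTrue_pair] at h ⊢
    simp [Code.eval, h.1]
  | right =>
    simp only [codeRules, List.mem_cons, List.not_mem_nil, or_false] at hr
    subst hr
    simp only [List.forall_mem_cons, Atom.subst, Atom.isTrue_code, Atom.isTrue_succ,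
        Atom.isTrue_pair] at h ⊢
    simp [Code.eval, h.1]
  | pair f g hf hg =>
    simp only [codeRules, List.mem_cons, List.mem_append] at hr
    rcases hr with rfl | hr | hr
    · simp only [List.forall_mem_cons, Atom.subst, Atom.isTrue_code, Atom.isTrue_succ,
        Atom.isTrue_pair] at h ⊢
      obtain ⟨h1, h2, h3, -⟩ := h
      simp only [Code.eval, Seq.seq, Part.map_eq_map, Part.mem_bind_iff, Part.mem_map_iff]
      exact ⟨_, ⟨_, h1, rfl⟩, _, h2, h3.symm⟩
    · exact hf hr
    · exact hg hr
  | comp f g hf hg =>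
    simp only [codeRules, List.mem_cons, List.mem_append] at hr
    rcases hr with rfl | hr | hr
    · simp only [List.forall_mem_cons, Atom.subst, Atom.isTrue_code, Atom.isTrue_succ,
        Atom.isTrue_pair] at h ⊢
      exact Part.mem_bind_iff.2 ⟨_, h.1, h.2.1⟩
    · exact hf hr
    · exact hg hr
  | prec f g hf hg =>
    simp only [codeRules, List.mem_cons, List.mem_append] at hr
    rcases hr with rfl | rfl | hr | hr
    · simp only [List.forall_mem_cons, Atom.subst, Atom.isTrue_code, Atom.isTrue_succ,
        Atom.isTrue_pair] at h ⊢
      rw [h.1, h0, Code.eval_prec_zero]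
      exact h.2.1
    · simp only [List.forall_mem_cons, Atom.subst, Atom.isTrue_code, Atom.isTrue_succ,
        Atom.isTrue_pair] at h ⊢
      obtain ⟨h1, h2, h3, h4, h5, h6, h7, -⟩ := h
      rw [h1, h2, Code.eval_prec_succ]
      rw [h3] at h4
      rw [h6, h5] at h7
      exact Part.mem_bind_iff.2 ⟨_, h4, h7⟩
    · exact hf hr
    · exact hg hr
  | rfind' f hf =>
    simp only [codeRules, List.mem_cons] at hr
    rcases hr with rfl | rfl | hr
    · simp only [List.forall_mem_cons, Atom.subst, Atom.isTrue_code, Atom.isTrue_succ,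
        Atom.isTrue_pair, h0] at h ⊢
      obtain ⟨h1, h2, -⟩ := h
      rw [h1] at h2 ⊢
      exact (mem_eval_rfind' _ _ _ _).2 (Or.inl ⟨h2, rfl⟩)
    · simp only [List.forall_mem_cons, Atom.subst, Atom.isTrue_code, Atom.isTrue_succ,
        Atom.isTrue_pair] at h ⊢
      obtain ⟨h1, h2, h3, h4, h5, h6, -⟩ := h
      rw [h1, h3] at h2
      rw [h5, h4] at h6
      rw [h1]
      exact (mem_eval_rfind' _ _ _ _).2 (Or.inr ⟨_, h2, h6⟩)
    · exact hf hr

theorem Derivable.isTrue {c : Code} {a : Atom} (h : Derivable (program c) a) : a.IsTrue := by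
  induction h with
  | succ x z => rfl
  | rule r σ hr h0 _ ih =>
    rcases List.mem_append.1 hr with hr | hr
    · exact baseRules_sound r hr σ h0 ih
    · exact codeRules_sound c r hr σ h0 ih

/-- The valuation that gives the variables `1, 2, …` the values in `l`. -/
def valuation (l : List ℕ) (i : ℕ) : ℕ := (0 :: l).getD i 0

/-! ### Completeness: halting computations are derivations. -/

theorem Derivable.of_rule {P : List Rule} (r : Rule) (l : List ℕ) {a : Atom} (hr : r ∈ P)
    (ha : r.head.subst (valuation l) = a)
    (hp : ∀ a ∈ r.prems.map (Atom.subst (valuation l)), Derivable P a) : Derivable P a :=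
  ha ▸ .rule r _ hr rfl fun _ hb => hp _ (List.mem_map_of_mem hb)

theorem derivable_less {P : List Rule} (hP : baseRules ⊆ P) {a b : ℕ} (h : a < b) :
    Derivable P ⟨1, a, b, 0⟩ := by
  induction b, h using Nat.le_induction with
  | base =>
    refine .of_rule _ [a, a + 1] (hP (List.mem_cons_self ..)) rfl ?_
    simpa [Atom.subst, valuation] using Derivable.succ a 0
  | succ b _ ih =>
    refine .of_rule ⟨⟨1, 1, 3, 0⟩, [⟨1, 1, 2, 0⟩, ⟨0, 2, 3, 0⟩]⟩ [a, b, b + 1]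
      (hP (by simp [baseRules])) rfl ?_
    simpa [Atom.subst, valuation] using ⟨ih, Derivable.succ b 0⟩

/-- The induction is on the value of the pairing function, not on its arguments. The rules walk
along the shells that `Nat.pair` enumerates: up the column `(a, b)` with `a < b`, over the corner
from `(a, a + 1)` to `(a + 1, 0)`, along `(a, b)` with `b < a`, and from `(b, b)` to the next shell
at `(0, b + 1)`. Each case below finds the point just before `(a, b)`. -/
theorem derivable_pair {P : List Rule} (hP : baseRules ⊆ P) (a b : ℕ) :
    Derivable P ⟨2, a, b, Nat.pair a b⟩ := by
  suffices ∀ c a b, Nat.pair a b = c → Derivable P ⟨2, a, b, c⟩ from this _ a b rfl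
  intro c
  induction c with
  | zero =>
    intro a b h
    obtain ⟨rfl, rfl⟩ : a = 0 ∧ b = 0 := by
      have := Nat.left_le_pair a b
      have := Nat.right_le_pair a b
      omega
    exact .of_rule ⟨⟨2, 0, 0, 0⟩, []⟩ [] (hP (by simp [baseRules])) rfl (by simp)
  | succ c ih =>
    intro a b h
    have hs := Derivable.succ (P := P) c 0
    rcases a with _ | a
    · rcases b with _ | b
      · simp [Nat.pair] at h
      · refine .of_rule ⟨⟨2, 0, 4, 5⟩, [⟨2, 1, 1, 3⟩, ⟨0, 1, 4, 0⟩, ⟨0, 3, 5, 0⟩]⟩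
          [b, 0, c, b + 1, c + 1] (hP (by simp [baseRules])) rfl ?_
        have := ih b b (by simp [Nat.pair] at h ⊢; nlinarith)
        simpa [Atom.subst, valuation] using ⟨this, Derivable.succ b 0, hs⟩
    · by_cases hab : a + 1 < b
      · refine .of_rule ⟨⟨2, 4, 2, 5⟩, [⟨2, 1, 2, 3⟩, ⟨0, 1, 4, 0⟩, ⟨0, 3, 5, 0⟩, ⟨1, 4, 2, 0⟩]⟩
          [a, b, c, a + 1, c + 1] (hP (by simp [baseRules])) rfl ?_
        have := ih a b (by rw [Nat.pair, if_pos hab] at h; rw [Nat.pair, if_pos (by omega)]; omega)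
        simpa [Atom.subst, valuation] using
          ⟨this, Derivable.succ a 0, hs, derivable_less hP hab⟩
      · rw [Nat.pair, if_neg hab] at h
        rcases b with _ | b
        · refine .of_rule ⟨⟨2, 2, 0, 5⟩, [⟨2, 1, 2, 3⟩, ⟨0, 1, 2, 0⟩, ⟨0, 3, 5, 0⟩]⟩
            [a, a + 1, c, 0, c + 1] (hP (by simp [baseRules])) rfl ?_
          have := ih a (a + 1) (by rw [Nat.pair, if_pos (by omega)]; omega)
          simpa [Atom.subst, valuation] using ⟨this, Derivable.succ a 0, hs⟩
        · refine .of_rule ⟨⟨2, 1, 4, 5⟩, [⟨2, 1, 2, 3⟩, ⟨1, 2, 1, 0⟩, ⟨0, 2, 4, 0⟩, ⟨0, 3, 5, 0⟩]⟩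
            [a + 1, b, c, b + 1, c + 1] (hP (by simp [baseRules])) rfl ?_
          have := ih (a + 1) b (by rw [Nat.pair, if_neg (by omega)]; omega)
          simpa [Atom.subst, valuation] using
            ⟨this, derivable_less hP (by omega : b < a + 1), Derivable.succ b 0, hs⟩

/-- Induction on the code, with an inner induction on the recursion argument for `prec` and on the
number of remaining search steps for `rfind'`. The list given to each rule is the values of its
variables `1, 2, …` in order. -/
theorem derivable_code {P : List Rule} (hP : baseRules ⊆ P) (c : Code) (hc : codeRules c ⊆ P)
    (n m : ℕ) (h : m ∈ c.eval n) : Derivable P ⟨codeTag c, n, m, 0⟩ := by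
  have pr := derivable_pair hP
  induction c generalizing n m with
  | zero =>
    obtain rfl : m = 0 := by simpa [Code.eval, pure, PFun.pure] using h
    exact .of_rule _ [n] (hc (List.mem_cons_self ..)) rfl (by simp)
  | succ =>
    obtain rfl : m = n + 1 := by simpa [Code.eval] using h
    refine .of_rule _ [n, n + 1] (hc (List.mem_cons_self ..)) rfl ?_
    simpa [Atom.subst, valuation] using Derivable.succ n 0
  | left =>
    obtain rfl : m = n.unpair.1 := by simpa [Code.eval] using h
    refine .of_rule _ [n.unpair.1, n.unpair.2, n] (hc (List.mem_cons_self ..)) rfl ?_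
    simpa [Atom.subst, valuation] using pr n.unpair.1 n.unpair.2
  | right =>
    obtain rfl : m = n.unpair.2 := by simpa [Code.eval] using h
    refine .of_rule _ [n.unpair.1, n.unpair.2, n] (hc (List.mem_cons_self ..)) rfl ?_
    simpa [Atom.subst, valuation] using pr n.unpair.1 n.unpair.2
  | pair f g hf hg =>
    simp only [codeRules, List.cons_subset, List.append_subset] at hc
    simp only [Code.eval, Seq.seq, Part.map_eq_map, Part.mem_bind_iff, Part.mem_map_iff] at h
    obtain ⟨_, ⟨a, ha, rfl⟩, b, hb, rfl⟩ := h
    refine .of_rule _ [n, a, b, Nat.pair a b] hc.1 rfl ?_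
    simpa [Atom.subst, valuation] using ⟨hf hc.2.1 n a ha, hg hc.2.2 n b hb, pr a b⟩
  | comp f g hf hg =>
    simp only [codeRules, List.cons_subset, List.append_subset] at hc
    obtain ⟨b, hb, hm⟩ := Part.mem_bind_iff.1 h
    refine .of_rule _ [n, b, m] hc.1 rfl ?_
    simpa [Atom.subst, valuation] using ⟨hg hc.2.2 n b hb, hf hc.2.1 b m hm⟩
  | prec f g hf hg =>
    simp only [codeRules, List.cons_subset, List.append_subset] at hc
    obtain ⟨a, k, rfl⟩ : ∃ a k, n = Nat.pair a k := ⟨_, _, (Nat.pair_unpair n).symm⟩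
    induction k generalizing m with
    | zero =>
      rw [Code.eval_prec_zero] at h
      refine .of_rule _ [a, Nat.pair a 0, m] hc.1 rfl ?_
      simpa [Atom.subst, valuation] using ⟨pr a 0, hf hc.2.2.1 a m h⟩
    | succ k ih =>
      rw [Code.eval_prec_succ] at h
      obtain ⟨r, hr, hm⟩ := Part.mem_bind_iff.1 h
      refine .of_rule _ [a, k, k + 1, Nat.pair a (k + 1), Nat.pair a k, r, Nat.pair k r,
        Nat.pair a (Nat.pair k r), m] hc.2.1 rfl ?_
      simpa [Atom.subst, valuation] using
        ⟨pr a (k + 1), Derivable.succ k 0, pr a k, ih r hr, pr k r, pr a (Nat.pair k r),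
          hg hc.2.2.2 _ m hm⟩
  | rfind' f hf =>
    simp only [codeRules, List.cons_subset] at hc
    obtain ⟨a, k, rfl⟩ : ∃ a k, n = Nat.pair a k := ⟨_, _, (Nat.pair_unpair n).symm⟩
    -- A search never returns a value below its starting point, so `m - k` can serve as the
    -- induction measure.
    have hle : ∀ k, m ∈ f.rfind'.eval (Nat.pair a k) → k ≤ m := by
      intro k h
      simp only [Code.eval, Nat.unpaired, Nat.unpair_pair, Part.mem_map_iff] at h
      obtain ⟨b, -, rfl⟩ := h
      exact Nat.le_add_left ..
    obtain ⟨d, hd⟩ := Nat.exists_eq_add_of_le (hle k h)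
    induction d generalizing k with
    | zero =>
      rcases (mem_eval_rfind' _ _ _ _).1 h with ⟨h0, rfl⟩ | ⟨v, hv, h⟩
      · refine .of_rule _ [a, m, Nat.pair a m] hc.1 rfl ?_
        simpa [Atom.subst, valuation] using ⟨pr a m, hf hc.2.2 _ 0 h0⟩
      · have := hle _ h
        omega
    | succ d ih =>
      rcases (mem_eval_rfind' _ _ _ _).1 h with ⟨h0, rfl⟩ | ⟨v, hv, h⟩
      · omega
      · refine .of_rule _ [a, k, Nat.pair a k, v, v + 1, k + 1, Nat.pair a (k + 1), m] hc.2.1 rfl ?_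
        simpa [Atom.subst, valuation] using
          ⟨pr a k, hf hc.2.2 _ _ hv, Derivable.succ v 0, Derivable.succ k 0, pr a (k + 1),
            ih (k + 1) h (by omega)⟩

theorem derivable_program_iff (c : Code) (n : ℕ) :
    (∃ y z, Derivable (program c) ⟨codeTag c, n, y, z⟩) ↔ (c.eval n).Dom := by
  constructor
  · rintro ⟨y, z, h⟩
    exact Part.dom_iff_mem.2 ⟨y, (Atom.isTrue_code c n y z).1 h.isTrue⟩
  · intro h
    obtain ⟨y, hy⟩ := Part.dom_iff_mem.1 h
    exact ⟨y, 0, derivable_code (List.subset_append_left ..) c (List.subset_append_right ..) n y hy⟩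

end

/-! ### Finite certificates of derivability -/

/-- `F` is a set of derivation steps, `L` a set of pairs and `V a o` the value of the attribute `a`
of `o`. A step `f` carries the derived ground atom (attributes `0` to `3`), a rank (attribute `4`)
and the values of the variables of the rule applied (attributes `7` to `16`); a pair has the
components `5` and `6`. The pairs form a strict order in which the premises of a step precede it. -/
structure Certificate (P : List Rule) (g n : ℕ) (F L : Set ℕ) (V : ℕ → ℕ → ℕ) : Prop where
  trans : ∀ l ∈ L, ∀ m ∈ L, V 6 l = V 5 m → ∃ k ∈ L, V 5 k = V 5 l ∧ V 6 k = V 6 m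
  irrefl : ∀ l ∈ L, V 5 l ≠ V 6 l
  succ : ∀ f ∈ F, V 0 f = 0 → (∃ l ∈ L, V 5 l = V 1 f ∧ V 6 l = V 2 f) ∧ V 2 f ≠ 0 ∧
    ∀ k ∈ F, V 0 k = 0 → V 2 k = V 2 f → V 1 k = V 1 f
  step : ∀ f ∈ F, V 0 f = 0 ∨ ∃ r ∈ P, V 7 f = 0 ∧ V 0 f = r.head.tag ∧
    V 1 f = V (7 + r.head.x) f ∧ V 2 f = V (7 + r.head.y) f ∧ V 3 f = V (7 + r.head.z) f ∧
    ∀ a ∈ r.prems, ∃ k ∈ F, V 0 k = a.tag ∧ V 1 k = V (7 + a.x) f ∧ V 2 k = V (7 + a.y) f ∧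
      V 3 k = V (7 + a.z) f ∧ ∃ l ∈ L, V 5 l = V 4 k ∧ V 6 l = V 4 f
  input : ∀ i < n, ∃ f ∈ F, V 0 f = 0 ∧ V 1 f = i ∧ V 2 f = i + 1
  goal : ∃ f ∈ F, V 0 f = g ∧ V 1 f = n

/-- In a certificate, values can be read as numbers in such a way that all steps are derivable. -/
theorem Certificate.derivable {P : List Rule} {g n : ℕ} {F L : Set ℕ} {V : ℕ → ℕ → ℕ}
    (h : Certificate P g n F L V) (hL : L.Finite) : ∃ y z, Derivable P ⟨g, n, y, z⟩ := by
  classical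
  -- The order given by the pairs serves both for ranks and for the values in successor steps.
  let R : ℕ → ℕ → Prop := fun u v => ∃ l ∈ L, V 5 l = u ∧ V 6 l = v
  have hfin : ∀ v, {u | R u v}.Finite := fun v =>
    (hL.image (V 5)).subset fun u ⟨l, hl, hu, _⟩ => ⟨l, hl, hu⟩
  -- By transitivity the predecessors of `u` precede `v`; by irreflexivity `u` itself is a new
  -- predecessor of `v`. Counting predecessors therefore strictly increases along `R`.
  have hrank : ∀ {u v}, R u v → {w | R w u}.ncard < {w | R w v}.ncard := by
    rintro u v ⟨l, hl, rfl, rfl⟩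
    refine Set.ncard_lt_ncard ⟨?_, fun hs => ?_⟩ (hfin _)
    · rintro w ⟨k, hk, rfl, hk'⟩
      obtain ⟨m, hm, h1, h2⟩ := h.trans k hk l hl hk'
      exact ⟨m, hm, h1, h2⟩
    · obtain ⟨k, hk, h1, h2⟩ := hs ⟨l, hl, rfl, rfl⟩
      exact h.irrefl k hk (h1.trans h2.symm)
  have hwf : WellFounded R :=
    Subrelation.wf (fun {u v} huv => hrank huv) (measure fun v => {w | R w v}.ncard).wf
  -- The successor relation claimed by the certificate: it lies inside the well-founded `R`, nothing
  -- precedes the value `0`, and predecessors are unique.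
  let S : ℕ → ℕ → Prop := fun x y => ∃ f ∈ F, V 0 f = 0 ∧ V 1 f = x ∧ V 2 f = y
  have hSR : ∀ {x y}, S x y → R x y := by
    rintro x y ⟨f, hf, h0, rfl, rfl⟩
    exact (h.succ f hf h0).1
  have hS0 : ∀ x, ¬ S x 0 := fun x ⟨f, hf, h0, _, hy⟩ => (h.succ f hf h0).2.1 hy
  have hSu : ∀ {x x' y}, S x y → S x' y → x = x' := by
    rintro x x' y ⟨f, hf, h0, rfl, rfl⟩ ⟨k, hk, h0', rfl, hy⟩
    exact ((h.succ f hf h0).2.2 k hk h0' hy).symm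
  -- The value `y` is read as the length of the chain of predecessors below it; values without
  -- predecessor are read as `0`. Different values may get the same reading, which is harmless
  -- because Horn rules contain no inequalities.
  obtain ⟨ι, hι0, hιS⟩ : ∃ ι : ℕ → ℕ, ι 0 = 0 ∧ ∀ x y, S x y → ι y = ι x + 1 := by
    let ι : ℕ → ℕ := hwf.fix fun y rec =>
      if hy : ∃ x, S x y then rec hy.choose (hSR hy.choose_spec) + 1 else 0
    have hι : ∀ y, ι y = if hy : ∃ x, S x y then ι hy.choose + 1 else 0 := fun y => hwf.fix_eq _ y
    refine ⟨ι, ?_, fun x y hxy => ?_⟩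
    · rw [hι, dif_neg]
      rintro ⟨x, hx⟩
      exact hS0 x hx
    · have hy : ∃ x, S x y := ⟨x, hxy⟩
      rw [hι, dif_pos hy, hSu hxy hy.choose_spec]
  -- Induction on the number of predecessors of the rank of a step; premises have smaller ranks.
  have hsteps : ∀ k, ∀ f ∈ F, {w | R w (V 4 f)}.ncard = k →
      Derivable P ⟨V 0 f, ι (V 1 f), ι (V 2 f), ι (V 3 f)⟩ := by
    intro k
    induction k using Nat.strong_induction_on with
    | _ k ih =>
      intro f hf hk
      rcases h.step f hf with h0 | ⟨r, hr, h0, ht, hx, hy, hz, hp⟩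
      · rw [h0, hιS _ _ ⟨f, hf, h0, rfl, rfl⟩]
        exact .succ _ _
      · rw [ht, hx, hy, hz]
        refine Derivable.rule r (fun i => ι (V (7 + i) f)) hr (by simp [h0, hι0]) fun a ha => ?_
        obtain ⟨k', hk', ht', hx', hy', hz', hl⟩ := hp a ha
        have := ih _ (hk ▸ hrank hl) k' hk' rfl
        rwa [ht', hx', hy', hz'] at this
  -- The input steps force the constants up to `n` to be read as themselves, so that the goal really
  -- speaks of `n`.
  have hin : ∀ i ≤ n, ι i = i := by
    intro i
    induction i with
    | zero => exact fun _ => hι0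
    | succ i ih =>
      intro hi
      obtain ⟨f, hf, h0, hx, hy⟩ := h.input i hi
      rw [hιS i (i + 1) ⟨f, hf, h0, hx, hy⟩, ih (by omega)]
  obtain ⟨f, hf, ht, hx⟩ := h.goal
  have := hsteps _ f hf rfl
  rw [ht, hx, hin n le_rfl] at this
  exact ⟨_, _, this⟩

/-- A set of ranked ground atoms each of which is an instance of the successor relation or follows
by a rule from atoms of smaller rank. -/
def Justified (P : List Rule) (S : Set (Atom × ℕ)) : Prop :=
  ∀ p ∈ S, (∃ x z, p.1 = ⟨0, x, x + 1, z⟩) ∨ ∃ r ∈ P, ∃ σ : ℕ → ℕ, σ 0 = 0 ∧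
    p.1 = r.head.subst σ ∧ ∀ a ∈ r.prems, ∃ k < p.2, (a.subst σ, k) ∈ S

theorem Justified.union {P : List Rule} {S T : Set (Atom × ℕ)} (hS : Justified P S)
    (hT : Justified P T) : Justified P (S ∪ T) := by
  rintro p (hp | hp)
  · rcases hS p hp with h | ⟨r, hr, σ, h0, hh, ha⟩
    · exact Or.inl h
    · exact Or.inr ⟨r, hr, σ, h0, hh, fun a h => (ha a h).imp fun k hk => ⟨hk.1, Or.inl hk.2⟩⟩
  · rcases hT p hp with h | ⟨r, hr, σ, h0, hh, ha⟩
    · exact Or.inl h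
    · exact Or.inr ⟨r, hr, σ, h0, hh, fun a h => (ha a h).imp fun k hk => ⟨hk.1, Or.inr hk.2⟩⟩

theorem exists_justified_list {P : List Rule} (l : List Atom)
    (h : ∀ a ∈ l, ∃ S : Set (Atom × ℕ), S.Finite ∧ Justified P S ∧ ∃ k, (a, k) ∈ S) :
    ∃ S : Set (Atom × ℕ), S.Finite ∧ Justified P S ∧ ∀ a ∈ l, ∃ k, (a, k) ∈ S := by
  induction l with
  | nil => exact ⟨∅, Set.finite_empty, fun _ h => h.elim, by simp⟩
  | cons a l ih =>
    rw [List.forall_mem_cons] at h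
    obtain ⟨S, hS, hSj, k, hk⟩ := h.1
    obtain ⟨T, hT, hTj, hTl⟩ := ih h.2
    refine ⟨S ∪ T, hS.union hT, hSj.union hTj, List.forall_mem_cons.2 ⟨⟨k, Or.inl hk⟩, ?_⟩⟩
    exact fun b hb => (hTl b hb).imp fun _ => Or.inr

/-- The certificates of the premises are merged, and the conclusion gets a rank above every rank in
use. The same atom may occur with several ranks. -/
theorem Derivable.exists_justified {P : List Rule} {a : Atom} (h : Derivable P a) :
    ∃ S : Set (Atom × ℕ), S.Finite ∧ Justified P S ∧ ∃ k, (a, k) ∈ S := by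
  induction h with
  | succ x z =>
    refine ⟨{((⟨0, x, x + 1, z⟩ : Atom), 0)}, Set.finite_singleton _, ?_, 0, Set.mem_singleton _⟩
    rintro p rfl
    exact Or.inl ⟨x, z, rfl⟩
  | rule r σ hr h0 _ ih =>
    obtain ⟨S, hS, hSj, hl⟩ := exists_justified_list (r.prems.map (Atom.subst σ)) (by simpa using ih)
    obtain ⟨N, hN⟩ := (hS.image Prod.snd).bddAbove
    refine ⟨insert (r.head.subst σ, N + 1) S, hS.insert _, ?_, N + 1, Set.mem_insert ..⟩
    rintro p (rfl | hp)
    · refine Or.inr ⟨r, hr, σ, h0, rfl, fun a ha => ?_⟩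
      obtain ⟨k, hk⟩ := hl _ (List.mem_map_of_mem ha)
      exact ⟨k, Nat.lt_succ_of_le (hN ⟨_, hk, rfl⟩), Or.inr hk⟩
    · rcases hSj p hp with h | ⟨r, hr, σ, h0, hh, ha⟩
      · exact Or.inl h
      · exact Or.inr ⟨r, hr, σ, h0, hh, fun a h => (ha a h).imp fun k hk => ⟨hk.1, Or.inr hk.2⟩⟩

/-! ### The model of a Horn program -/

/-- `C.allInstances()`. -/
def allOf (c : ℕ) : Path := ⟨.allInstances c false, []⟩

/-- The attribute `a` of the variable `x`. -/
def attrOf (x a : ℕ) : ValExpr := .attr ⟨.var x, []⟩ a false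

def OCL.imp (φ ψ : OCL) : OCL := .or (.not φ) ψ

def OCL.conj (l : List OCL) : OCL := l.foldr .and .tt

def OCL.disj (l : List OCL) : OCL := l.foldr .or (.not .tt)

/-- Class `0` is the artifact, with initial state `1` and termination state `2`; class `3` holds
the steps and class `4` the ordered pairs of a certificate. -/
def certDiagram : ClassDiagram where
  numClasses := 5
  isa := [(1, 0), (2, 0)]
  assocs := []
  attrs := (List.range 17).map fun a => ⟨if a = 5 ∨ a = 6 then 4 else 3, true⟩
  roClasses := []
  roAssocs := []

/-- The pair in variable `x` relates the value of `s` to that of `t`. -/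
def pairsOCL (x : ℕ) (s t : ValExpr) : OCL :=
  .and (.valIncludesAll (attrOf x 5) s) (.valIncludesAll (attrOf x 6) t)

/-- This and the next formulas transcribe the fields of `Certificate`. On required single-valued
attributes, inclusion of value sets is equality. -/
def transOCL : OCL :=
  .forAll (allOf 4) 1 (.forAll (allOf 4) 2 (.imp (.valIncludesAll (attrOf 1 6) (attrOf 2 5))
    (.exists_ (allOf 4) 3 (pairsOCL 3 (attrOf 1 5) (attrOf 2 6)))))

def irreflOCL : OCL := .forAll (allOf 4) 1 (.not (.valIncludesAll (attrOf 1 5) (attrOf 1 6)))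

def succOCL : OCL :=
  .forAll (allOf 3) 1 (.imp (.valIncludesAll (attrOf 1 0) (.const 0))
    (.and (.exists_ (allOf 4) 2 (pairsOCL 2 (attrOf 1 1) (attrOf 1 2)))
      (.and (.not (.valIncludesAll (attrOf 1 2) (.const 0)))
        (.forAll (allOf 3) 2 (.imp (.valIncludesAll (attrOf 2 0) (.const 0))
          (.imp (.valIncludesAll (attrOf 2 2) (attrOf 1 2))
            (.valIncludesAll (attrOf 2 1) (attrOf 1 1))))))))

/-- The step in variable `x` derives the instance of `a` given by the step in variable `1`. -/
def atomOCL (x : ℕ) (a : Atom) : OCL :=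
  .and (.valIncludesAll (attrOf x 0) (.const a.tag))
    (.and (.valIncludesAll (attrOf x 1) (attrOf 1 (7 + a.x)))
      (.and (.valIncludesAll (attrOf x 2) (attrOf 1 (7 + a.y)))
        (.valIncludesAll (attrOf x 3) (attrOf 1 (7 + a.z)))))

/-- Object variable `1` is the step being checked, `2` a step deriving the premise, and `3` a pair
witnessing that the premise has smaller rank. -/
def premOCL (a : Atom) : OCL :=
  .exists_ (allOf 3) 2 (.and (atomOCL 2 a)
    (.exists_ (allOf 4) 3 (pairsOCL 3 (attrOf 2 4) (attrOf 1 4))))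

/-- Attribute `7 + i` of a step stores the value of rule variable `i`; the first conjunct is the
convention that variable `0` stands for zero. -/
def ruleOCL (r : Rule) : OCL :=
  .and (.valIncludesAll (attrOf 1 7) (.const 0))
    (.and (atomOCL 1 r.head) (.conj (r.prems.map premOCL)))

def stepOCL (P : List Rule) : OCL :=
  .forAll (allOf 3) 1 (.or (.valIncludesAll (attrOf 1 0) (.const 0)) (.disj (P.map ruleOCL)))

def inputOCL (i : ℕ) : OCL :=
  .exists_ (allOf 3) 1 (.and (.valIncludesAll (attrOf 1 0) (.const 0))
    (.and (.valIncludesAll (attrOf 1 1) (.const i)) (.valIncludesAll (attrOf 1 2) (.const (i + 1)))))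

def goalOCL (g n : ℕ) : OCL :=
  .exists_ (allOf 3) 1 (.and (.valIncludesAll (attrOf 1 0) (.const g))
    (.valIncludesAll (attrOf 1 1) (.const n)))

/-- The constraint `φ`, imposed once some artifact instance is in the termination state. -/
def onTermination (φ : OCL) : OCL := .or (.isEmpty (allOf 2)) φ

/-- The constraints that describe a certificate. -/
def certOCL (P : List Rule) (g n : ℕ) : List OCL :=
  [transOCL, irreflOCL, succOCL, stepOCL P, goalOCL g n] ++ (List.range n).map inputOCL

/-- A sequence of a single task. -/
def taskActivity (t : Task) : Activity where
  nodes := [.initial, .action t, .final]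
  edges := [⟨0, 1, .tt⟩, ⟨1, 2, .tt⟩]

def createTask : Task := ⟨true, .tt, .oclIsTypeOf 0 1⟩

/-- The contract asks only for the new state. The certificate comes in through legality: an
execution must end in a base that contains one. -/
def completeTask : Task := ⟨false, .tt, .oclIsTypeOf 0 2⟩

def certArtifact : Artifact where
  cls := 0
  initial := 1
  final := 2
  transitions := [⟨none, 0, .tt, 1⟩, ⟨some 1, 1, .tt, 2⟩]
  activities := [taskActivity createTask, taskActivity completeTask]

/-- Instances of the artifact are created in state `1` and completed, that is, moved to state `2`;
an instance can be in state `2` only in the presence of a certificate. -/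
def certModel (P : List Rule) (g n : ℕ) : Model where
  diagram := certDiagram
  constraints := (certOCL P g n).map onTermination
  artifacts := [certArtifact]

/-! ### Well-formedness -/

theorem certDiagram_sub {c d : ℕ} :
    certDiagram.Sub c d ↔ c = d ∨ (d = 0 ∧ (c = 1 ∨ c = 2)) := by
  constructor
  · intro h
    induction h with
    | refl => exact Or.inl rfl
    | tail _ h ih =>
      simp only [certDiagram, List.mem_cons, Prod.mk.injEq, List.not_mem_nil, or_false] at h
      omega
  · rintro (rfl | ⟨rfl, rfl | rfl⟩)
    · exact .refl
    · exact .single (by simp [certDiagram])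
    · exact .single (by simp [certDiagram])

theorem certDiagram_attrs {a : ℕ} {d : Attr} : certDiagram.attrs[a]? = some d ↔
    a < 17 ∧ d = ⟨if a = 5 ∨ a = 6 then 4 else 3, true⟩ := by
  simp only [certDiagram, List.getElem?_map]
  by_cases h : a < 17 <;> simp [h, eq_comm]

theorem certArtifact_isState {c : ℕ} :
    certArtifact.IsState certDiagram c ↔ c = 1 ∨ c = 2 := by
  simp only [Artifact.IsState, certDiagram_sub, ClassDiagram.IsLeaf]
  simp only [certArtifact, certDiagram, List.mem_cons, Prod.mk.injEq, List.not_mem_nil, or_false]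
  grind

theorem OCL.ok_conj {M : ClassDiagram} {op post : Bool} {sc : List ℕ} {l : List OCL}
    (h : ∀ φ ∈ l, φ.Ok M op post sc) : (OCL.conj l).Ok M op post sc := by
  induction l with
  | nil => trivial
  | cons φ l ih =>
    rw [List.forall_mem_cons] at h
    exact ⟨h.1, ih h.2⟩

theorem OCL.ok_disj {M : ClassDiagram} {op post : Bool} {sc : List ℕ} {l : List OCL}
    (h : ∀ φ ∈ l, φ.Ok M op post sc) : (OCL.disj l).Ok M op post sc := by
  induction l with
  | nil => trivial
  | cons φ l ih =>
    rw [List.forall_mem_cons] at h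
    exact ⟨h.1, ih h.2⟩

theorem certOCL_ok {P : List Rule} (hP : ∀ r ∈ P, r.WellFormed) (g n : ℕ) :
    ∀ φ ∈ certOCL P g n, φ.Ok certDiagram false false [] := by
  have hlen : certDiagram.attrs.length = 17 := by simp [certDiagram]
  have hnum : certDiagram.numClasses = 5 := rfl
  -- The bound `10` on rule variables keeps the attributes `7 + i` below `17`.
  have hatom : ∀ x sc (a : Atom), a.Bounded → x ∈ sc → 1 ∈ sc →
      (atomOCL x a).Ok certDiagram false false sc := by
    rintro x sc a ⟨h1, h2, h3⟩ hx hsc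
    simp [atomOCL, attrOf, OCL.Ok, ValExpr.Ok, Path.Ok, Source.Ok, hlen, hx, hsc]
    omega
  have hstep : (stepOCL P).Ok certDiagram false false [] := by
    refine ⟨by simp [allOf, Path.Ok, Source.Ok, hnum], ?_, OCL.ok_disj ?_⟩
    · simp [attrOf, OCL.Ok, ValExpr.Ok, Path.Ok, Source.Ok, hlen]
    · simp only [List.forall_mem_map]
      intro r hr
      refine ⟨?_, hatom _ _ _ (hP r hr).2.1 (by simp) (by simp), OCL.ok_conj ?_⟩
      · simp [attrOf, OCL.Ok, ValExpr.Ok, Path.Ok, Source.Ok, hlen]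
      · simp only [List.forall_mem_map]
        intro a ha
        refine ⟨by simp [allOf, Path.Ok, Source.Ok, hnum],
          hatom _ _ _ ((hP r hr).2.2 a ha) (by simp) (by simp), ?_⟩
        simp [allOf, attrOf, pairsOCL, OCL.Ok, ValExpr.Ok, Path.Ok, Source.Ok, hlen, hnum]
  simp only [certOCL, List.forall_mem_append, List.forall_mem_cons, List.forall_mem_map]
  refine ⟨⟨?_, ?_, ?_, hstep, ?_, by simp⟩, fun i _ => ?_⟩ <;>
  simp [transOCL, irreflOCL, succOCL, goalOCL, inputOCL, OCL.imp, allOf, attrOf, pairsOCL, OCL.Ok,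
    ValExpr.Ok, Path.Ok, Source.Ok, hlen, hnum]

theorem taskActivity_inEdges (t : Task) (n : ℕ) :
    (taskActivity t).inEdges n = if n = 1 then [0] else if n = 2 then [1] else [] := by
  simp only [Activity.inEdges, taskActivity, List.length_cons, List.length_nil]
  split_ifs with h1 h2
  · subst h1; rfl
  · subst h2; rfl
  · simp [List.range_succ, Ne.symm h1, Ne.symm h2]

theorem taskActivity_outEdges (t : Task) (n : ℕ) :
    (taskActivity t).outEdges n = if n = 0 then [0] else if n = 1 then [1] else [] := by
  simp only [Activity.outEdges, taskActivity, List.length_cons, List.length_nil]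
  split_ifs with h1 h2
  · subst h1; rfl
  · subst h2; rfl
  · simp [List.range_succ, Ne.symm h1, Ne.symm h2]

theorem taskActivity_nodes {t : Task} {n : ℕ} {k : Node} :
    (taskActivity t).nodes[n]? = some k ↔
      (n = 0 ∧ k = .initial) ∨ (n = 1 ∧ k = .action t) ∨ (n = 2 ∧ k = .final) := by
  rcases n with _ | _ | _ | n <;> simp [taskActivity, eq_comm]

theorem taskActivity_hasTask {t t' : Task} : (taskActivity t).HasTask t' ↔ t' = t := by
  simp [Activity.HasTask, taskActivity]

theorem taskActivity_wellFormed {M : ClassDiagram} {t : Task}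
    (ht : t.pre.Ok M true false (if t.creates then [] else [0]) ∧ t.post.Ok M true true [0]) :
    (taskActivity t).WellFormed M where
  edge_ends := by simp [taskActivity]
  initial_unique := ⟨0, rfl, fun n hn => by simpa [taskActivity_nodes] using hn⟩
  degrees := by
    intro n k h
    rw [taskActivity_inEdges, taskActivity_outEdges]
    rcases taskActivity_nodes.1 h with ⟨rfl, rfl⟩ | ⟨rfl, rfl⟩ | ⟨rfl, rfl⟩ <;>
      simp [Node.DegreesOk]
  guards := by simp [taskActivity]
  guard_ok := by simp [taskActivity, OCL.Ok]
  task_ok := by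
    intro t' h
    rwa [taskActivity_hasTask.1 h]

theorem certArtifact_wellFormed : certArtifact.WellFormed certDiagram where
  cls_valid := by simp [certArtifact, certDiagram]
  cls_top := by simp [certArtifact, certDiagram]
  cls_rw := by simp [certDiagram]
  initial_state := certArtifact_isState.2 (Or.inl rfl)
  final_state := certArtifact_isState.2 (Or.inr rfl)
  trans_states := by simp [certArtifact_isState]; simp [certArtifact]
  trans_event := by simp [certArtifact]
  trans_cond := by simp [certArtifact, OCL.Ok]
  trans_creates := by simp [certArtifact, taskActivity_hasTask, completeTask]
  activity_ok := by
    simp only [certArtifact, List.forall_mem_cons]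
    refine ⟨taskActivity_wellFormed ?_, taskActivity_wellFormed ?_, by simp⟩ <;>
      simp [createTask, completeTask, OCL.Ok, certDiagram]

theorem certModel_wellFormed {P : List Rule} (hP : ∀ r ∈ P, r.WellFormed) (g n : ℕ) :
    (certModel P g n).WellFormed where
  isa_valid := by simp [certModel, certDiagram]
  isa_acyclic := by
    have h : ∀ c d, Relation.TransGen (fun c d => (c, d) ∈ certDiagram.isa) c d → d < c := by
      intro c d h
      induction h with
      | single h => simp [certDiagram] at h; omega
      | tail _ h ih => simp [certDiagram] at h; omega
    exact fun c hc => lt_irrefl _ (h c c hc)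
  assoc_valid := by simp [certModel, certDiagram]
  attr_valid := by
    simp only [certModel, certDiagram, List.forall_mem_map]
    intro a _
    split_ifs <;> omega
  constraint_ok := by
    simp only [certModel, List.forall_mem_map]
    exact fun φ hφ => ⟨by simp [OCL.Ok, allOf, Path.Ok, Source.Ok, certDiagram], certOCL_ok hP g n φ hφ⟩
  artifact_ok := by simpa [certModel] using certArtifact_wellFormed
  artifact_disjoint := by
    intro i j A A' hi hj
    have : ∀ i A, (certModel P g n).artifacts[i]? = some A → i = 0 := by
      intro i A h
      have := (List.getElem?_eq_some_iff.1 h).1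
      simpa [certModel] using this
    intros
    rw [this i A hi, this j A' hj]

/-- Conditions and contracts contain no paths, and navigationality does not concern the constraints,
the only expressions that use `allInstances`. Without associations no class depends on any other. -/
theorem certModel_unidirectional (P : List Rule) (g n : ℕ) :
    (certModel P g n).Unidirectional := by
  refine ⟨⟨?_, ?_⟩, ?_⟩
  · simp [Model.HasTask, certModel, certArtifact, taskActivity_hasTask, createTask, completeTask,
      OCL.Navigational]
  · simp [Model.HasCond, certModel, certArtifact, taskActivity, OCL.Navigational]
  · have hstep : ∀ c d, ¬ (certModel P g n).DependsStep c d := by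
      simp [Model.DependsStep, certModel, certDiagram]
    intro c _ _ d _ h
    cases h with
    | single h => exact hstep _ _ h
    | tail _ h => exact hstep _ _ h

/-! ### Semantics of the constraints -/

/-- The steps stored in an information base. -/
def steps (I : InfoBase) : Set ℕ := {o | certDiagram.HasType I o 3}

/-- The pairs stored in an information base. -/
def pairs (I : InfoBase) : Set ℕ := {o | certDiagram.HasType I o 4}

/-- The value of the attribute `a` of `o`. -/
noncomputable def attrValue (I : InfoBase) (a o : ℕ) : ℕ := sInf {v | Fact.val a o v ∈ I}

theorem hasType_iff_inst {I : InfoBase} {o c : ℕ} (hc : c ≠ 0) :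
    certDiagram.HasType I o c ↔ Fact.inst o c ∈ I := by
  simp [ClassDiagram.HasType, certDiagram_sub, hc]

/-- The attribute `a` is declared for the object `o`. -/
def HasAttr (I : InfoBase) (a o : ℕ) : Prop :=
  ∃ d, certDiagram.attrs[a]? = some d ∧ certDiagram.HasType I o d.owner

theorem hasAttr_step {I : InfoBase} {o : ℕ} (ho : o ∈ steps I) {a : ℕ}
    (ha : a < 5 ∨ 7 ≤ a ∧ a < 17) : HasAttr I a o :=
  ⟨_, certDiagram_attrs.2 ⟨by omega, rfl⟩, by rwa [if_neg (by omega)]⟩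

theorem hasAttr_pair {I : InfoBase} {o : ℕ} (ho : o ∈ pairs I) {a : ℕ}
    (ha : a = 5 ∨ a = 6) : HasAttr I a o :=
  ⟨_, certDiagram_attrs.2 ⟨by omega, rfl⟩, by rwa [if_pos ha]⟩

theorem attrValue_of_mem {I : InfoBase} (hI : certDiagram.IsInstance I) {a o v : ℕ}
    (h : Fact.val a o v ∈ I) : attrValue I a o = v := by
  have : {w | Fact.val a o w ∈ I} = {v} :=
    Set.eq_singleton_iff_unique_mem.2 ⟨h, fun w hw => hI.val_unique a o w v hw h⟩
  rw [attrValue, this, csInf_singleton]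

/-- Required and single-valued attributes denote singletons, which turns `valIncludesAll` into an
equality test. -/
theorem eval_attrOf {I : InfoBase} (hI : certDiagram.IsInstance I) {π ρ : ℕ → Option ℕ}
    {x a o : ℕ} (hx : ρ x = some o) (ha : HasAttr I a o) :
    (attrOf x a).eval certDiagram I I π ρ = {attrValue I a o} := by
  obtain ⟨d, hd, ht⟩ := ha
  obtain ⟨v, hv⟩ := hI.val_required a d o hd (by rw [(certDiagram_attrs.1 hd).2]) ht
  rw [attrValue_of_mem hI hv]
  ext w
  simp only [attrOf, ValExpr.eval, Path.eval, Source.eval, List.foldl_nil, Set.mem_ofPred_eq, hx,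
    Option.some.injEq, ite_self, exists_eq_left', Set.mem_singleton_iff]
  exact ⟨fun hw => hI.val_unique a o w v hw hv, fun hw => hw ▸ hv⟩

theorem holds_attr_attr {I : InfoBase} (hI : certDiagram.IsInstance I) {π ρ : ℕ → Option ℕ}
    {x a o y b o' : ℕ} (hx : ρ x = some o) (hy : ρ y = some o') (ha : HasAttr I a o)
    (hb : HasAttr I b o') :
    (OCL.valIncludesAll (attrOf x a) (attrOf y b)).Holds certDiagram I I π ρ ↔
      attrValue I a o = attrValue I b o' := by
  rw [OCL.Holds, eval_attrOf hI hx ha, eval_attrOf hI hy hb, Set.singleton_subset_singleton,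
    eq_comm]

theorem holds_attr_const {I : InfoBase} (hI : certDiagram.IsInstance I) {π ρ : ℕ → Option ℕ}
    {x a o v : ℕ} (hx : ρ x = some o) (ha : HasAttr I a o) :
    (OCL.valIncludesAll (attrOf x a) (.const v)).Holds certDiagram I I π ρ ↔
      attrValue I a o = v := by
  rw [OCL.Holds, eval_attrOf hI hx ha, ValExpr.eval, Set.singleton_subset_singleton, eq_comm]

theorem OCL.holds_imp {M : ClassDiagram} {I₀ I : InfoBase} {π ρ : ℕ → Option ℕ} {φ ψ : OCL} :
    (OCL.imp φ ψ).Holds M I₀ I π ρ ↔ (φ.Holds M I₀ I π ρ → ψ.Holds M I₀ I π ρ) :=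
  imp_iff_not_or.symm

theorem OCL.holds_conj {M : ClassDiagram} {I₀ I : InfoBase} {π ρ : ℕ → Option ℕ} {l : List OCL} :
    (OCL.conj l).Holds M I₀ I π ρ ↔ ∀ φ ∈ l, φ.Holds M I₀ I π ρ := by
  induction l with
  | nil => simp [OCL.conj, OCL.Holds]
  | cons φ l ih =>
    rw [List.forall_mem_cons, ← ih]
    rfl

theorem OCL.holds_disj {M : ClassDiagram} {I₀ I : InfoBase} {π ρ : ℕ → Option ℕ} {l : List OCL} :
    (OCL.disj l).Holds M I₀ I π ρ ↔ ∃ φ ∈ l, φ.Holds M I₀ I π ρ := by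
  induction l with
  | nil => simp [OCL.disj, OCL.Holds]
  | cons φ l ih =>
    rw [List.exists_mem_cons_iff, ← ih]
    rfl

theorem holds_forAll_pairs {I : InfoBase} {π ρ : ℕ → Option ℕ} {x : ℕ} {φ : OCL} :
    (OCL.forAll (allOf 4) x φ).Holds certDiagram I I π ρ ↔
      ∀ o ∈ pairs I, φ.Holds certDiagram I I π (Function.update ρ x (some o)) := Iff.rfl

theorem holds_exists_pairs {I : InfoBase} {π ρ : ℕ → Option ℕ} {x : ℕ} {φ : OCL} :
    (OCL.exists_ (allOf 4) x φ).Holds certDiagram I I π ρ ↔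
      ∃ o ∈ pairs I, φ.Holds certDiagram I I π (Function.update ρ x (some o)) := Iff.rfl

theorem holds_forAll_steps {I : InfoBase} {π ρ : ℕ → Option ℕ} {x : ℕ} {φ : OCL} :
    (OCL.forAll (allOf 3) x φ).Holds certDiagram I I π ρ ↔
      ∀ o ∈ steps I, φ.Holds certDiagram I I π (Function.update ρ x (some o)) := Iff.rfl

theorem holds_exists_steps {I : InfoBase} {π ρ : ℕ → Option ℕ} {x : ℕ} {φ : OCL} :
    (OCL.exists_ (allOf 3) x φ).Holds certDiagram I I π ρ ↔
      ∃ o ∈ steps I, φ.Holds certDiagram I I π (Function.update ρ x (some o)) := Iff.rfl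

theorem OCL.holds_and {M : ClassDiagram} {I₀ I : InfoBase} {π ρ : ℕ → Option ℕ} {φ ψ : OCL} :
    (OCL.and φ ψ).Holds M I₀ I π ρ ↔ φ.Holds M I₀ I π ρ ∧ ψ.Holds M I₀ I π ρ := Iff.rfl

theorem OCL.holds_or {M : ClassDiagram} {I₀ I : InfoBase} {π ρ : ℕ → Option ℕ} {φ ψ : OCL} :
    (OCL.or φ ψ).Holds M I₀ I π ρ ↔ φ.Holds M I₀ I π ρ ∨ ψ.Holds M I₀ I π ρ := Iff.rfl

theorem OCL.holds_not {M : ClassDiagram} {I₀ I : InfoBase} {π ρ : ℕ → Option ℕ} {φ : OCL} :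
    (OCL.not φ).Holds M I₀ I π ρ ↔ ¬ φ.Holds M I₀ I π ρ := Iff.rfl

section
variable {I : InfoBase} {π ρ : ℕ → Option ℕ}

theorem holds_exists_pairsOCL (hI : certDiagram.IsInstance I) {x y z a b o o' : ℕ} (hyx : y ≠ x)
    (hzx : z ≠ x) (hy : ρ y = some o) (hz : ρ z = some o') (ha : HasAttr I a o)
    (hb : HasAttr I b o') :
    (OCL.exists_ (allOf 4) x (pairsOCL x (attrOf y a) (attrOf z b))).Holds certDiagram I I π ρ ↔
      ∃ l ∈ pairs I, attrValue I 5 l = attrValue I a o ∧ attrValue I 6 l = attrValue I b o' := by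
  rw [holds_exists_pairs]
  refine exists_congr fun l => and_congr_right fun hl => ?_
  have hx : Function.update ρ x (some l) x = some l := Function.update_self ..
  rw [← Function.update_of_ne hyx (some l) ρ] at hy
  rw [← Function.update_of_ne hzx (some l) ρ] at hz
  rw [pairsOCL, OCL.holds_and, holds_attr_attr hI hx hy (hasAttr_pair hl (Or.inl rfl)) ha,
    holds_attr_attr hI hx hz (hasAttr_pair hl (Or.inr rfl)) hb]

theorem holds_transOCL (hI : certDiagram.IsInstance I) : transOCL.Holds certDiagram I I π ρ ↔
    ∀ l ∈ pairs I, ∀ m ∈ pairs I, attrValue I 6 l = attrValue I 5 m →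
      ∃ k ∈ pairs I, attrValue I 5 k = attrValue I 5 l ∧ attrValue I 6 k = attrValue I 6 m := by
  rw [transOCL, holds_forAll_pairs]
  refine forall₂_congr fun l hl => ?_
  rw [holds_forAll_pairs]
  refine forall₂_congr fun m hm => ?_
  have h1 : Function.update (Function.update ρ 1 (some l)) 2 (some m) 1 = some l := rfl
  have h2 : Function.update (Function.update ρ 1 (some l)) 2 (some m) 2 = some m := rfl
  rw [OCL.holds_imp, holds_attr_attr hI h1 h2 (hasAttr_pair hl (Or.inr rfl))
    (hasAttr_pair hm (Or.inl rfl)), holds_exists_pairsOCL hI (by simp) (by simp) h1 h2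
    (hasAttr_pair hl (Or.inl rfl)) (hasAttr_pair hm (Or.inr rfl))]

theorem holds_irreflOCL (hI : certDiagram.IsInstance I) : irreflOCL.Holds certDiagram I I π ρ ↔
    ∀ l ∈ pairs I, attrValue I 5 l ≠ attrValue I 6 l := by
  rw [irreflOCL, holds_forAll_pairs]
  refine forall₂_congr fun l hl => ?_
  have h1 : Function.update ρ 1 (some l) 1 = some l := rfl
  rw [OCL.holds_not, holds_attr_attr hI h1 h1 (hasAttr_pair hl (Or.inl rfl))
    (hasAttr_pair hl (Or.inr rfl))]

theorem holds_succOCL (hI : certDiagram.IsInstance I) : succOCL.Holds certDiagram I I π ρ ↔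
    ∀ f ∈ steps I, attrValue I 0 f = 0 →
      (∃ l ∈ pairs I, attrValue I 5 l = attrValue I 1 f ∧ attrValue I 6 l = attrValue I 2 f) ∧
      attrValue I 2 f ≠ 0 ∧ ∀ k ∈ steps I, attrValue I 0 k = 0 →
        attrValue I 2 k = attrValue I 2 f → attrValue I 1 k = attrValue I 1 f := by
  rw [succOCL, holds_forAll_steps]
  refine forall₂_congr fun f hf => ?_
  have hfa : ∀ a < 5, HasAttr I a f := fun _ h => hasAttr_step hf (Or.inl h)
  have h1 : Function.update ρ 1 (some f) 1 = some f := rfl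
  rw [OCL.holds_imp, OCL.holds_and, OCL.holds_and, OCL.holds_not,
    holds_attr_const hI h1 (hfa 0 (by simp)), holds_attr_const hI h1 (hfa 2 (by simp)),
    holds_exists_pairsOCL hI (by simp) (by simp) h1 h1 (hfa 1 (by simp)) (hfa 2 (by simp)), holds_forAll_steps]
  refine imp_congr_right fun _ => and_congr_right fun _ => and_congr_right fun _ =>
    forall₂_congr fun k hk => ?_
  have hka : ∀ a < 5, HasAttr I a k := fun _ h => hasAttr_step hk (Or.inl h)
  have h1 : Function.update (Function.update ρ 1 (some f)) 2 (some k) 1 = some f := rfl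
  have h2 : Function.update (Function.update ρ 1 (some f)) 2 (some k) 2 = some k := rfl
  rw [OCL.holds_imp, OCL.holds_imp, holds_attr_const hI h2 (hka 0 (by simp)),
    holds_attr_attr hI h2 h1 (hka 2 (by simp)) (hfa 2 (by simp)), holds_attr_attr hI h2 h1 (hka 1 (by simp)) (hfa 1 (by simp))]

theorem holds_atomOCL (hI : certDiagram.IsInstance I) {x f k : ℕ} (hx : ρ x = some k)
    (h1 : ρ 1 = some f) (hk : k ∈ steps I) (hf : f ∈ steps I) {a : Atom} (ha : a.Bounded) :
    (atomOCL x a).Holds certDiagram I I π ρ ↔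
      attrValue I 0 k = a.tag ∧ attrValue I 1 k = attrValue I (7 + a.x) f ∧
      attrValue I 2 k = attrValue I (7 + a.y) f ∧ attrValue I 3 k = attrValue I (7 + a.z) f := by
  have hka : ∀ i < 5, HasAttr I i k := fun _ h => hasAttr_step hk (Or.inl h)
  have hfa : ∀ i < 10, HasAttr I (7 + i) f := fun i hi => hasAttr_step hf (by omega)
  rw [atomOCL, OCL.holds_and, OCL.holds_and, OCL.holds_and, holds_attr_const hI hx (hka 0 (by simp)),
    holds_attr_attr hI hx h1 (hka 1 (by simp)) (hfa _ ha.1), holds_attr_attr hI hx h1 (hka 2 (by simp)) (hfa _ ha.2.1),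
    holds_attr_attr hI hx h1 (hka 3 (by simp)) (hfa _ ha.2.2)]

theorem holds_stepOCL (hI : certDiagram.IsInstance I) {P : List Rule} (hP : ∀ r ∈ P, r.WellFormed) :
    (stepOCL P).Holds certDiagram I I π ρ ↔
    ∀ f ∈ steps I, attrValue I 0 f = 0 ∨ ∃ r ∈ P, attrValue I 7 f = 0 ∧
      attrValue I 0 f = r.head.tag ∧ attrValue I 1 f = attrValue I (7 + r.head.x) f ∧
      attrValue I 2 f = attrValue I (7 + r.head.y) f ∧
      attrValue I 3 f = attrValue I (7 + r.head.z) f ∧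
      ∀ a ∈ r.prems, ∃ k ∈ steps I, attrValue I 0 k = a.tag ∧
        attrValue I 1 k = attrValue I (7 + a.x) f ∧ attrValue I 2 k = attrValue I (7 + a.y) f ∧
        attrValue I 3 k = attrValue I (7 + a.z) f ∧
        ∃ l ∈ pairs I, attrValue I 5 l = attrValue I 4 k ∧ attrValue I 6 l = attrValue I 4 f := by
  rw [stepOCL, holds_forAll_steps]
  refine forall₂_congr fun f hf => ?_
  have h1 : Function.update ρ 1 (some f) 1 = some f := rfl
  rw [OCL.holds_or, holds_attr_const hI h1 (hasAttr_step hf (Or.inl (Nat.zero_lt_succ _))),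
    OCL.holds_disj]
  simp only [List.mem_map, exists_exists_and_eq_and]
  refine or_congr_right (exists_congr fun r => and_congr_right fun hr => ?_)
  have hf7 : HasAttr I 7 f := hasAttr_step hf (by simp)
  rw [ruleOCL, OCL.holds_and, OCL.holds_and, holds_attr_const hI h1 hf7,
    holds_atomOCL hI h1 h1 hf hf (hP r hr).2.1, OCL.holds_conj, List.forall_mem_map]
  simp only [and_assoc]
  refine and_congr_right fun _ => and_congr_right fun _ => and_congr_right fun _ =>
    and_congr_right fun _ => and_congr_right fun _ => forall₂_congr fun a ha => ?_
  rw [premOCL, holds_exists_steps]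
  refine exists_congr fun k => and_congr_right fun hk => ?_
  have h1 : Function.update (Function.update ρ 1 (some f)) 2 (some k) 1 = some f := rfl
  have h2 : Function.update (Function.update ρ 1 (some f)) 2 (some k) 2 = some k := rfl
  have hf4 : HasAttr I 4 f := hasAttr_step hf (by simp)
  have hk4 : HasAttr I 4 k := hasAttr_step hk (by simp)
  rw [OCL.holds_and, holds_atomOCL hI h2 h1 hk hf ((hP r hr).2.2 a ha),
    holds_exists_pairsOCL hI (by simp) (by simp) h2 h1 hk4 hf4]
  simp only [and_assoc]

theorem holds_inputOCL (hI : certDiagram.IsInstance I) {i : ℕ} :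
    (inputOCL i).Holds certDiagram I I π ρ ↔
    ∃ f ∈ steps I, attrValue I 0 f = 0 ∧ attrValue I 1 f = i ∧ attrValue I 2 f = i + 1 := by
  rw [inputOCL, holds_exists_steps]
  refine exists_congr fun f => and_congr_right fun hf => ?_
  have hfa : ∀ a < 5, HasAttr I a f := fun _ h => hasAttr_step hf (Or.inl h)
  have h1 : Function.update ρ 1 (some f) 1 = some f := rfl
  rw [OCL.holds_and, OCL.holds_and, holds_attr_const hI h1 (hfa 0 (by simp)),
    holds_attr_const hI h1 (hfa 1 (by simp)), holds_attr_const hI h1 (hfa 2 (by simp))]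

theorem holds_goalOCL (hI : certDiagram.IsInstance I) {g n : ℕ} :
    (goalOCL g n).Holds certDiagram I I π ρ ↔
    ∃ f ∈ steps I, attrValue I 0 f = g ∧ attrValue I 1 f = n := by
  rw [goalOCL, holds_exists_steps]
  refine exists_congr fun f => and_congr_right fun hf => ?_
  have hfa : ∀ a < 5, HasAttr I a f := fun _ h => hasAttr_step hf (Or.inl h)
  have h1 : Function.update ρ 1 (some f) 1 = some f := rfl
  rw [OCL.holds_and, holds_attr_const hI h1 (hfa 0 (by simp)), holds_attr_const hI h1 (hfa 1 (by simp))]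

theorem holds_certOCL (hI : certDiagram.IsInstance I) {P : List Rule} (hP : ∀ r ∈ P, r.WellFormed)
    {g n : ℕ} : (∀ φ ∈ certOCL P g n, φ.Holds certDiagram I I π ρ) ↔
      Certificate P g n (steps I) (pairs I) (attrValue I) := by
  simp only [certOCL, List.forall_mem_append, List.forall_mem_cons, List.forall_mem_map,
    holds_transOCL hI, holds_irreflOCL hI, holds_succOCL hI, holds_stepOCL hI hP,
    holds_goalOCL hI, holds_inputOCL hI, List.mem_range]
  constructor
  · rintro ⟨⟨h1, h2, h3, h4, h5, -⟩, h6⟩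
    exact ⟨h1, h2, h3, h4, h6, h5⟩
  · rintro ⟨h1, h2, h3, h4, h6, h5⟩
    exact ⟨⟨h1, h2, h3, h4, h5, by simp⟩, h6⟩

end

/-- Legal information bases of the model of a Horn program. -/
theorem certModel_legal_iff {P : List Rule} (hP : ∀ r ∈ P, r.WellFormed) {g n : ℕ} {I : InfoBase} :
    (certModel P g n).Legal I ↔ certDiagram.IsInstance I ∧ (∀ o, Fact.inst o 0 ∉ I) ∧
      ((∃ o, Fact.inst o 2 ∈ I) → Certificate P g n (steps I) (pairs I) (attrValue I)) := by
  refine and_congr_right fun hI => and_congr ?_ ?_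
  · simp only [certModel, List.mem_singleton, forall_eq, certArtifact_isState, certDiagram_sub]
    constructor
    · intro h o ho
      simpa using h o 0 ho (Or.inl rfl)
    · rintro h o c hc (rfl | hc')
      · exact absurd hc (h o)
      · exact hc'.2
  · rw [← holds_certOCL hI hP (π := noVal) (ρ := selfEnv none)]
    simp only [certModel, List.forall_mem_map, OCL.CondHolds, onTermination, OCL.holds_or]
    have : (OCL.isEmpty (allOf 2)).Holds certDiagram I I noVal (selfEnv none) ↔
        ¬ ∃ o, Fact.inst o 2 ∈ I := by
      rw [OCL.Holds, Set.eq_empty_iff_forall_notMem, not_exists]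
      exact forall_congr' fun o => not_congr (hasType_iff_inst (by simp))
    simp only [this, ← imp_iff_not_or]
    exact ⟨fun h ho φ hφ => h φ hφ ho, fun h φ hφ ho => h ho φ hφ⟩

theorem certModel_legal_empty {P : List Rule} (hP : ∀ r ∈ P, r.WellFormed) (g n : ℕ) :
    (certModel P g n).Legal ∅ := by
  refine (certModel_legal_iff hP).2 ⟨?_, by simp, by simp⟩
  constructor <;> simp [ClassDiagram.HasType]

/-- An information base is finite, so its pairs are finitely many, as well-foundedness in
`Certificate.derivable` requires. -/
theorem derivable_of_legal {P : List Rule} (hP : ∀ r ∈ P, r.WellFormed) {g n : ℕ} {I : InfoBase}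
    (hI : (certModel P g n).Legal I) {o : ℕ} (ho : Fact.inst o 2 ∈ I) :
    ∃ y z, Derivable P ⟨g, n, y, z⟩ := by
  obtain ⟨-, -, hc⟩ := (certModel_legal_iff hP).1 hI
  refine (hc ⟨o, ho⟩).derivable ?_
  refine (Set.Finite.preimage (f := fun o => Fact.inst o 4) (fun a _ b _ h => by simpa using h)
    I.finite_toSet).subset fun o ho => ?_
  exact (hasType_iff_inst (by simp)).1 ho

/-! ### Information bases from derivations -/

section
variable (S : Finset (Atom × ℕ)) (σ : Atom × ℕ → ℕ → ℕ) (e : Atom × ℕ → ℕ) (N o : ℕ)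

/-- The value of the attribute `a` of the step that derives the ranked atom `p`. -/
def stepValue (p : Atom × ℕ) : ℕ → ℕ
  | 0 => p.1.tag
  | 1 => p.1.x
  | 2 => p.1.y
  | 3 => p.1.z
  | 4 => p.2
  | a => σ p (a - 7)

/-- The attributes of steps. -/
def stepAttrs : Finset ℕ := (Finset.range 17).filter fun a => a ≠ 5 ∧ a ≠ 6

/-- The object that represents the ranked atom `p`. -/
def stepId (p : Atom × ℕ) : ℕ := o + 1 + 2 * e p

/-- The object that represents the pair `(i, j)`. -/
def pairId (q : ℕ × ℕ) : ℕ := o + 2 + 2 * Nat.pair q.1 q.2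

/-- An information base with the artifact instance `o` in the termination state, a step for each
ranked atom in `S` and the pairs `i < j < N`. -/
def certBase : InfoBase :=
  {Fact.inst o 2} ∪
  (S.image fun p => Fact.inst (stepId e o p) 3) ∪
  ((S ×ˢ stepAttrs).image fun p => Fact.val p.2 (stepId e o p.1) (stepValue σ p.1 p.2)) ∪
  (((Finset.range N ×ˢ Finset.range N).filter fun q => q.1 < q.2).biUnion fun q =>
    {Fact.inst (pairId o q) 4, Fact.val 5 (pairId o q) q.1, Fact.val 6 (pairId o q) q.2})

variable {S σ e N o}

theorem inst_mem_certBase {u c : ℕ} : Fact.inst u c ∈ certBase S σ e N o ↔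
    (u = o ∧ c = 2) ∨ (∃ p ∈ S, u = stepId e o p ∧ c = 3) ∨
      ∃ i j, i < j ∧ j < N ∧ u = pairId o (i, j) ∧ c = 4 := by
  simp only [certBase, Finset.mem_union, Finset.mem_singleton, Finset.mem_image,
    Finset.mem_biUnion, Finset.mem_filter, Finset.mem_product, Finset.mem_range,
    Finset.mem_insert, Fact.inst.injEq, reduceCtorEq, and_false, exists_false, or_false,
    Prod.exists, or_assoc]
  refine or_congr_right (or_congr ?_ ?_)
  · exact exists_congr fun a => exists_congr fun k => and_congr_right fun _ => by grind
  · exact exists_congr fun i => exists_congr fun j =>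
      ⟨fun h => ⟨h.1.2, h.1.1.2, h.2⟩, fun h => ⟨⟨⟨h.1.trans h.2.1, h.2.1⟩, h.1⟩, h.2.2⟩⟩

theorem val_mem_certBase {u a v : ℕ} : Fact.val a u v ∈ certBase S σ e N o ↔
    (∃ p ∈ S, a ∈ stepAttrs ∧ u = stepId e o p ∧ v = stepValue σ p a) ∨
      ∃ i j, i < j ∧ j < N ∧ u = pairId o (i, j) ∧ ((a = 5 ∧ v = i) ∨ (a = 6 ∧ v = j)) := by
  simp only [certBase, Finset.mem_union, Finset.mem_singleton, Finset.mem_image,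
    Finset.mem_biUnion, Finset.mem_filter, Finset.mem_product, Finset.mem_range,
    Finset.mem_insert, Fact.val.injEq, reduceCtorEq, and_false, exists_false, false_or]
  refine or_congr ?_ ?_
  · constructor
    · rintro ⟨⟨p, b⟩, ⟨hp, hb⟩, rfl, rfl, rfl⟩
      exact ⟨p, hp, hb, rfl, rfl⟩
    · rintro ⟨p, hp, hb, rfl, rfl⟩
      exact ⟨(p, a), ⟨hp, hb⟩, rfl, rfl, rfl⟩
  · constructor
    · rintro ⟨⟨i, j⟩, ⟨⟨hi, hj⟩, hij⟩, h⟩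
      exact ⟨i, j, hij, hj, by grind⟩
    · rintro ⟨i, j, hij, hj, h⟩
      exact ⟨(i, j), ⟨⟨hij.trans hj, hj⟩, hij⟩, by grind⟩

theorem link_notMem_certBase {r u v : ℕ} : Fact.link r u v ∉ certBase S σ e N o := by
  simp [certBase]

/-- Relative to the artifact instance `o`, steps sit at odd offsets and pairs at positive even ones,
so the three kinds of objects never collide. -/
theorem stepId_ne_pairId {p : Atom × ℕ} {q : ℕ × ℕ} : stepId e o p ≠ pairId o q := by
  simp only [stepId, pairId]
  omega

theorem pairId_inj {i j i' j' : ℕ} : pairId o (i, j) = pairId o (i', j') ↔ i = i' ∧ j = j' := by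
  rw [← Nat.pair_eq_pair]
  simp only [pairId]
  omega

theorem stepId_inj (he : Function.Injective e) {p q : Atom × ℕ} :
    stepId e o p = stepId e o q ↔ p = q := by
  rw [← he.eq_iff]
  simp only [stepId]
  omega

theorem certBase_isInstance (he : Function.Injective e) :
    certDiagram.IsInstance (certBase S σ e N o) where
  inst_class := by
    intro u c h
    rcases inst_mem_certBase.1 h with ⟨-, rfl⟩ | ⟨_, _, -, rfl⟩ | ⟨_, _, _, _, -, rfl⟩ <;>
      simp [certDiagram]
  inst_unique := by
    intro u c d hc hd
    rw [inst_mem_certBase] at hc hd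
    rcases hc with ⟨h, rfl⟩ | ⟨_, _, h, rfl⟩ | ⟨_, _, _, _, h, rfl⟩ <;>
    rcases hd with ⟨h', rfl⟩ | ⟨_, _, h', rfl⟩ | ⟨_, _, _, _, h', rfl⟩ <;>
    first | rfl | (simp only [stepId, pairId] at h h'; omega)
  link_typed := fun _ _ _ h => (link_notMem_certBase h).elim
  im_mult := by simp [certDiagram]
  dom_mult := by simp [certDiagram]
  val_typed := by
    intro a u v h
    rcases val_mem_certBase.1 h with ⟨p, hp, ha, rfl, -⟩ | ⟨i, j, hij, hj, rfl, ha⟩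
    · simp only [stepAttrs, Finset.mem_filter, Finset.mem_range] at ha
      refine ⟨_, certDiagram_attrs.2 ⟨ha.1, rfl⟩, ?_⟩
      rw [if_neg (by omega), hasType_iff_inst (by simp), inst_mem_certBase]
      exact Or.inr (Or.inl ⟨p, hp, rfl, rfl⟩)
    · refine ⟨_, certDiagram_attrs.2 ⟨by omega, rfl⟩, ?_⟩
      rw [if_pos (by omega), hasType_iff_inst (by simp), inst_mem_certBase]
      exact Or.inr (Or.inr ⟨i, j, hij, hj, rfl, rfl⟩)
  val_unique := by
    intro a u v w hv hw
    rw [val_mem_certBase] at hv hw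
    rcases hv with ⟨p, hp, ha, rfl, rfl⟩ | ⟨i, j, hij, hj, rfl, ha⟩
    · rcases hw with ⟨q, hq, -, h, rfl⟩ | ⟨i, j, hij, hj, h, -⟩
      · rw [(stepId_inj he).1 h]
      · exact (stepId_ne_pairId h).elim
    · rcases hw with ⟨q, hq, -, h, rfl⟩ | ⟨i', j', hij', hj', h, ha'⟩
      · exact (stepId_ne_pairId h.symm).elim
      · obtain ⟨rfl, rfl⟩ := pairId_inj.1 h
        omega
  val_required := by
    intro a d u hd _ hu
    obtain ⟨ha, rfl⟩ := certDiagram_attrs.1 hd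
    dsimp only at hu
    split_ifs at hu with h56
    · rw [hasType_iff_inst (by simp), inst_mem_certBase] at hu
      obtain ⟨i, j, hij, hj, rfl⟩ : ∃ i j, i < j ∧ j < N ∧ u = pairId o (i, j) := by simpa using hu
      refine ⟨if a = 5 then i else j, val_mem_certBase.2 (Or.inr ⟨i, j, hij, hj, rfl, ?_⟩)⟩
      clear hu
      split_ifs <;> omega
    · rw [hasType_iff_inst (by simp), inst_mem_certBase] at hu
      obtain ⟨p, hp, rfl⟩ : ∃ p ∈ S, u = stepId e o p := by simpa using hu
      refine ⟨_, val_mem_certBase.2 (Or.inl ⟨p, hp, ?_, rfl, rfl⟩)⟩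
      clear hu
      simp only [stepAttrs, Finset.mem_filter, Finset.mem_range]
      omega

theorem mem_steps_certBase {u : ℕ} :
    u ∈ steps (certBase S σ e N o) ↔ ∃ p ∈ S, u = stepId e o p := by
  rw [steps, Set.mem_ofPred_eq, hasType_iff_inst (by simp), inst_mem_certBase]
  simp

theorem mem_pairs_certBase {u : ℕ} :
    u ∈ pairs (certBase S σ e N o) ↔ ∃ i j, i < j ∧ j < N ∧ u = pairId o (i, j) := by
  rw [pairs, Set.mem_ofPred_eq, hasType_iff_inst (by simp), inst_mem_certBase]
  simp

theorem attrValue_stepId (he : Function.Injective e) {p : Atom × ℕ} (hp : p ∈ S) {a : ℕ}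
    (ha : a ∈ stepAttrs) :
    attrValue (certBase S σ e N o) a (stepId e o p) = stepValue σ p a :=
  attrValue_of_mem (certBase_isInstance he) (val_mem_certBase.2 (Or.inl ⟨p, hp, ha, rfl, rfl⟩))

theorem attrValue_pairId (he : Function.Injective e) {i j : ℕ} (hij : i < j) (hj : j < N) :
    attrValue (certBase S σ e N o) 5 (pairId o (i, j)) = i ∧
      attrValue (certBase S σ e N o) 6 (pairId o (i, j)) = j :=
  ⟨attrValue_of_mem (certBase_isInstance he)
      (val_mem_certBase.2 (Or.inr ⟨i, j, hij, hj, rfl, Or.inl ⟨rfl, rfl⟩⟩)),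
    attrValue_of_mem (certBase_isInstance he)
      (val_mem_certBase.2 (Or.inr ⟨i, j, hij, hj, rfl, Or.inr ⟨rfl, rfl⟩⟩))⟩

/-- The stored pairs are the usual order on the numbers below `N`. Hence `N` has to exceed the ranks
and also the second arguments of atoms, since successor steps need a pair for their two values. -/
theorem certBase_certificate {P : List Rule} (hP : ∀ r ∈ P, r.WellFormed) {g n : ℕ}
    (he : Function.Injective e) (hN : ∀ p ∈ S, p.1.y < N ∧ p.2 < N)
    (hS : ∀ p ∈ S, p.1.tag = 0 ∨ ∃ r ∈ P, σ p 0 = 0 ∧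
      p.1 = r.head.subst (σ p) ∧ ∀ a ∈ r.prems, ∃ k < p.2, (a.subst (σ p), k) ∈ S)
    (hsucc : ∀ p ∈ S, p.1.tag = 0 → p.1.y = p.1.x + 1)
    (hin : ∀ i < n, ∃ p ∈ S, p.1.tag = 0 ∧ p.1.x = i)
    (hgoal : ∃ p ∈ S, p.1.tag = g ∧ p.1.x = n) :
    Certificate P g n (steps (certBase S σ e N o)) (pairs (certBase S σ e N o))
      (attrValue (certBase S σ e N o)) := by
  have hv : ∀ p ∈ S, ∀ a ∈ stepAttrs,
      attrValue (certBase S σ e N o) a (stepId e o p) = stepValue σ p a :=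
    fun p hp a ha => attrValue_stepId he hp ha
  have hv0 : ∀ p ∈ S, attrValue (certBase S σ e N o) 0 (stepId e o p) = p.1.tag :=
    fun p hp => hv p hp 0 (by decide)
  have hv1 : ∀ p ∈ S, attrValue (certBase S σ e N o) 1 (stepId e o p) = p.1.x :=
    fun p hp => hv p hp 1 (by decide)
  have hv2 : ∀ p ∈ S, attrValue (certBase S σ e N o) 2 (stepId e o p) = p.1.y :=
    fun p hp => hv p hp 2 (by decide)
  have hv3 : ∀ p ∈ S, attrValue (certBase S σ e N o) 3 (stepId e o p) = p.1.z :=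
    fun p hp => hv p hp 3 (by decide)
  have hv4 : ∀ p ∈ S, attrValue (certBase S σ e N o) 4 (stepId e o p) = p.2 :=
    fun p hp => hv p hp 4 (by decide)
  have hv7 : ∀ p ∈ S, ∀ i < 10,
      attrValue (certBase S σ e N o) (7 + i) (stepId e o p) = σ p i := by
    intro p hp i hi
    rw [hv p hp _ (by simp only [stepAttrs, Finset.mem_filter, Finset.mem_range]; omega)]
    -- In this form the index falls into the last case of `stepValue`; the side goals exclude the
    -- five cases before it.
    have : 7 + i = i + 2 + 5 := by ring
    rw [this, stepValue]
    · congr 1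
    all_goals intro h; omega
  have hpair : ∀ i j, i < j → j < N → ∃ l ∈ pairs (certBase S σ e N o),
      attrValue (certBase S σ e N o) 5 l = i ∧ attrValue (certBase S σ e N o) 6 l = j :=
    fun i j hij hj => ⟨_, mem_pairs_certBase.2 ⟨i, j, hij, hj, rfl⟩, attrValue_pairId he hij hj⟩
  refine ⟨?_, ?_, ?_, ?_, ?_, ?_⟩
  · intro l hl m hm h
    obtain ⟨i, j, hij, hj, rfl⟩ := mem_pairs_certBase.1 hl
    obtain ⟨i', j', hij', hj', rfl⟩ := mem_pairs_certBase.1 hm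
    rw [(attrValue_pairId he hij hj).2, (attrValue_pairId he hij' hj').1] at h
    rw [(attrValue_pairId he hij hj).1, (attrValue_pairId he hij' hj').2]
    exact hpair i j' (by omega) hj'
  · intro l hl
    obtain ⟨i, j, hij, hj, rfl⟩ := mem_pairs_certBase.1 hl
    rw [(attrValue_pairId he hij hj).1, (attrValue_pairId he hij hj).2]
    exact hij.ne
  · intro f hf h0
    obtain ⟨p, hp, rfl⟩ := mem_steps_certBase.1 hf
    rw [hv0 p hp] at h0
    rw [hv1 p hp, hv2 p hp]
    have hy := hsucc p hp h0
    refine ⟨hpair _ _ (by omega) (hN p hp).1, by omega, fun k hk hk0 hky => ?_⟩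
    obtain ⟨q, hq, rfl⟩ := mem_steps_certBase.1 hk
    rw [hv0 q hq] at hk0
    rw [hv2 q hq] at hky
    rw [hv1 q hq]
    have := hsucc q hq hk0
    omega
  · intro f hf
    obtain ⟨p, hp, rfl⟩ := mem_steps_certBase.1 hf
    rw [hv0 p hp, hv1 p hp, hv2 p hp, hv3 p hp, hv4 p hp]
    rcases hS p hp with h | ⟨r, hr, h0, hh, hprem⟩
    · exact Or.inl h
    · obtain ⟨-, ⟨hx, hy, hz⟩, hb⟩ := hP r hr
      refine Or.inr ⟨r, hr, ?_, ?_, ?_, ?_, ?_, fun a ha => ?_⟩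
      · rw [← h0, ← hv7 p hp 0 (by simp)]
      · rw [hh]; rfl
      · rw [hv7 p hp _ hx, hh]; rfl
      · rw [hv7 p hp _ hy, hh]; rfl
      · rw [hv7 p hp _ hz, hh]; rfl
      · obtain ⟨k, hk, hka⟩ := hprem a ha
        obtain ⟨hax, hay, haz⟩ := hb a ha
        refine ⟨_, mem_steps_certBase.2 ⟨_, hka, rfl⟩, hv0 _ hka, ?_, ?_, ?_, ?_⟩
        · rw [hv1 _ hka, hv7 p hp _ hax]; rfl
        · rw [hv2 _ hka, hv7 p hp _ hay]; rfl
        · rw [hv3 _ hka, hv7 p hp _ haz]; rfl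
        · rw [hv4 _ hka]
          exact hpair _ _ hk (hN p hp).2
  · intro i hi
    obtain ⟨p, hp, h0, hx⟩ := hin i hi
    refine ⟨_, mem_steps_certBase.2 ⟨p, hp, rfl⟩, ?_, ?_, ?_⟩
    · rw [hv0 p hp, h0]
    · rw [hv1 p hp, hx]
    · rw [hv2 p hp, hsucc p hp h0, hx]
  · obtain ⟨p, hp, h0, hx⟩ := hgoal
    exact ⟨_, mem_steps_certBase.2 ⟨p, hp, rfl⟩, by rw [hv0 p hp, h0], by rw [hv1 p hp, hx]⟩

end

/-- A derivable goal can be certified, whatever artifact instance is to be terminated. -/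
theorem exists_legal_of_derivable {P : List Rule} (hP : ∀ r ∈ P, r.WellFormed) {g n y z : ℕ}
    (h : Derivable P ⟨g, n, y, z⟩) (o : ℕ) :
    ∃ J, (certModel P g n).Legal J ∧ Fact.inst o 2 ∈ J := by
  classical
  -- Besides the goal, the successor atoms for all `i < n` are included, because the input
  -- constraints demand them.
  obtain ⟨S, hfin, hS, hl⟩ := exists_justified_list
    (⟨g, n, y, z⟩ :: (List.range n).map fun i => (⟨0, i, i + 1, 0⟩ : Atom))
    (P := P) (by
      simp only [List.forall_mem_cons, List.forall_mem_map]
      exact ⟨h.exists_justified, fun i _ => (Derivable.succ i 0).exists_justified⟩)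
  simp only [List.forall_mem_cons, List.forall_mem_map, List.mem_range] at hl
  obtain ⟨⟨k, hk⟩, hin⟩ := hl
  obtain ⟨N, hN⟩ := (hfin.image fun p => max p.1.y p.2).bddAbove
  obtain ⟨e, he⟩ : ∃ e : Atom × ℕ → ℕ, Function.Injective e :=
    ⟨fun p => Encodable.encode (p.1.tag, p.1.x, p.1.y, p.1.z, p.2), fun p q hpq => by
      obtain ⟨⟨_, _, _, _⟩, _⟩ := p
      obtain ⟨⟨_, _, _, _⟩, _⟩ := q
      simpa [and_assoc] using hpq⟩
  -- Successor atoms come from no rule; their variable attributes are required but unconstrained,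
  -- and `id` fills them.
  have hσ : ∀ p, ∃ σ : ℕ → ℕ, p ∈ S → p.1.tag = 0 ∨ ∃ r ∈ P, σ 0 = 0 ∧
      p.1 = r.head.subst σ ∧ ∀ a ∈ r.prems, ∃ k < p.2, (a.subst σ, k) ∈ S := by
    intro p
    by_cases hp : p ∈ S
    · rcases hS p hp with ⟨x, z, hx⟩ | ⟨r, hr, σ, hσ⟩
      · exact ⟨id, fun _ => Or.inl (by rw [hx])⟩
      · exact ⟨σ, fun _ => Or.inr ⟨r, hr, hσ⟩⟩
    · exact ⟨id, fun h => (hp h).elim⟩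
  choose σ hσ using hσ
  refine ⟨certBase hfin.toFinset σ e (N + 1) o, (certModel_legal_iff hP).2
    ⟨certBase_isInstance he, fun u hu => ?_, fun _ => certBase_certificate hP he ?_ ?_ ?_ ?_ ?_⟩,
    inst_mem_certBase.2 (Or.inl ⟨rfl, rfl⟩)⟩
  · simpa using inst_mem_certBase.1 hu
  · intro p hp
    have : max p.1.y p.2 ≤ N := hN ⟨p, hfin.mem_toFinset.1 hp, rfl⟩
    omega
  · simpa only [hfin.mem_toFinset] using hσ
  · intro p hp h0
    rcases hS p (hfin.mem_toFinset.1 hp) with ⟨x, z, hx⟩ | ⟨r, hr, σ, -, hh, -⟩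
    · rw [hx]
    -- No rule has a successor head, so an atom with tag `0` is a true successor fact.
    · rw [hh] at h0
      exact absurd h0 (hP r hr).1
  · intro i hi
    obtain ⟨k, hk⟩ := hin i hi
    exact ⟨_, hfin.mem_toFinset.2 hk, rfl, rfl⟩
  · exact ⟨_, hfin.mem_toFinset.2 hk, rfl, rfl⟩

/-! ### Runs of the model -/

/-- If some information base is admissible as the result of a task, then the task can be executed. -/
theorem Task.exists_exec {B : Model} {A : Artifact} {t : Task} {self self' : Option ℕ}
    {I J : InfoBase} {π : ℕ → ℕ} (hself : if t.creates = true then self = none else self' = self)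
    (htype : ∀ o, self = some o → B.diagram.HasType I o A.cls)
    (hpre : t.pre.Holds B.diagram I I (fun i => some (π i)) (selfEnv self))
    (hJ : t.Admissible B A π self' I J) : ∃ J', t.Exec B A self self' I J' := by
  -- A change with the fewest facts is also minimal for inclusion, and a base is determined by its
  -- symmetric difference with `I`.
  obtain ⟨J', hJ', hmin⟩ := WellFounded.has_min
    (measure fun K : InfoBase => (symmDiff I K).card).wf {K | t.Admissible B A π self' I K} ⟨J, hJ⟩
  refine ⟨J', hself, htype, π, hpre, hJ', fun K hK hsub => ?_⟩
  have hle : (symmDiff I J').card ≤ (symmDiff I K).card := not_lt.1 (hmin K hK)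
  exact symmDiff_right_injective I (Finset.eq_of_subset_of_card_le hsub hle)

theorem certModel_artifacts {P : List Rule} {g n i : ℕ} {A : Artifact} :
    (certModel P g n).artifacts[i]? = some A ↔ i = 0 ∧ A = certArtifact := by
  rcases i with _ | i <;> simp [certModel, eq_comm]

theorem certArtifact_transitions {k : ℕ} {t : Transition} :
    certArtifact.transitions[k]? = some t ↔
      (k = 0 ∧ t = ⟨none, 0, .tt, 1⟩) ∨ (k = 1 ∧ t = ⟨some 1, 1, .tt, 2⟩) := by
  rcases k with _ | _ | k <;> simp [certArtifact, eq_comm]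

theorem certArtifact_activities {k : ℕ} {Q : Activity} :
    certArtifact.activities[k]? = some Q ↔
      (k = 0 ∧ Q = taskActivity createTask) ∨ (k = 1 ∧ Q = taskActivity completeTask) := by
  rcases k with _ | _ | k <;> simp [certArtifact, eq_comm]

section
variable {P : List Rule} {g n : ℕ}

/-- Nothing in the diagram is read-only, so the condition on the read-only part is vacuous. -/
theorem certModel_admissible_iff {t : Task} {s w : ℕ} (ht : t.post = .oclIsTypeOf 0 s) {π : ℕ → ℕ}
    {I J : InfoBase} : t.Admissible (certModel P g n) certArtifact π (some w) I J ↔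
      (certModel P g n).Legal J ∧ Fact.inst w s ∈ J ∧
        (t.creates = true → ¬ I.Exists w ∧ certDiagram.HasType J w 0) := by
  have hro : ∀ f, ¬ certDiagram.ROFact f := by
    rintro (_ | _ | _) <;> simp [ClassDiagram.ROFact, ClassDiagram.ROAttr, certDiagram]
  rw [Task.Admissible, ht]
  simp [certModel, hro, OCL.Holds, selfEnv, certArtifact]

/-- The class of the artifact instance `w` replaced by the state `s`. -/
def moveTo (I : InfoBase) (w s : ℕ) : InfoBase :=
  insert (Fact.inst w s) (I \ {Fact.inst w 1, Fact.inst w 2})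

/-- With an instance `o` already terminated, `I` contains a certificate. Artifact instances carry no
attributes, so changing the class of `w` leaves steps, pairs and values untouched. -/
theorem certModel_legal_moveTo (hP : ∀ r ∈ P, r.WellFormed) {I : InfoBase}
    (hI : (certModel P g n).Legal I) {o w s : ℕ} (ho : Fact.inst o 2 ∈ I) (hs : s = 1 ∨ s = 2)
    (hw : ∀ c, Fact.inst w c ∈ I → c = 1 ∨ c = 2) : (certModel P g n).Legal (moveTo I w s) := by
  obtain ⟨hinst, h0, hcert⟩ := (certModel_legal_iff hP).1 hI
  have hval : ∀ a u v, Fact.val a u v ∈ moveTo I w s ↔ Fact.val a u v ∈ I := by simp [moveTo]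
  have hobj : ∀ u c, Fact.inst u c ∈ moveTo I w s ↔
      (u = w ∧ c = s) ∨ (u ≠ w ∧ Fact.inst u c ∈ I) := by
    intro u c
    simp only [moveTo, Finset.mem_insert, Finset.mem_sdiff, Finset.mem_singleton, Fact.inst.injEq]
    by_cases h : u = w
    · subst h
      have := hw c
      simp only [true_and, ne_eq, not_true_eq_false, false_and, or_false]
      tauto
    · simp [h]
  have hdata : ∀ u c, c = 3 ∨ c = 4 →
      (certDiagram.HasType (moveTo I w s) u c ↔ certDiagram.HasType I u c) := by
    intro u c hc
    rw [hasType_iff_inst (by omega), hasType_iff_inst (by omega), hobj]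
    constructor
    · rintro (⟨-, h⟩ | ⟨-, h⟩)
      · omega
      · exact h
    · intro h
      refine Or.inr ⟨?_, h⟩
      rintro rfl
      have := hw c h
      omega
  have howner : ∀ (a : ℕ) (d : Attr) (u : ℕ), certDiagram.attrs[a]? = some d →
      (certDiagram.HasType (moveTo I w s) u d.owner ↔ certDiagram.HasType I u d.owner) := by
    intro a d u hd
    obtain ⟨-, rfl⟩ := certDiagram_attrs.1 hd
    refine hdata _ _ ?_
    dsimp only
    split_ifs <;> simp
  refine (certModel_legal_iff hP).2 ⟨?_, ?_, fun _ => ?_⟩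
  · constructor
    · intro u c hc
      rcases (hobj u c).1 hc with ⟨-, rfl⟩ | ⟨-, h⟩
      · rcases hs with rfl | rfl <;> simp [certDiagram]
      · exact hinst.inst_class u c h
    · intro u c d hc hd
      have := hinst.inst_unique u c d
      grind
    · intro r u v h
      have : Fact.link r u v ∈ I := by simpa [moveTo] using h
      obtain ⟨a, ha, -⟩ := hinst.link_typed r u v this
      simp [certDiagram] at ha
    · simp [certDiagram]
    · simp [certDiagram]
    · intro a u v h
      obtain ⟨d, hd, ht⟩ := hinst.val_typed a u v ((hval a u v).1 h)
      exact ⟨d, hd, (howner a d u hd).2 ht⟩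
    · intro a u v v' h h'
      exact hinst.val_unique a u v v' ((hval a u v).1 h) ((hval a u v').1 h')
    · intro a d u hd hr ht
      obtain ⟨v, hv⟩ := hinst.val_required a d u hd hr ((howner a d u hd).1 ht)
      exact ⟨v, (hval a u v).2 hv⟩
  · intro u hu
    rcases (hobj u 0).1 hu with ⟨-, rfl⟩ | ⟨-, h⟩
    · omega
    · exact h0 u h
  · have h3 : steps (moveTo I w s) = steps I := Set.ext fun u => hdata u 3 (by simp)
    have h4 : pairs (moveTo I w s) = pairs I := Set.ext fun u => hdata u 4 (by simp)
    have hv : attrValue (moveTo I w s) = attrValue I := by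
      funext a u
      simp only [attrValue, hval]
    rw [h3, h4, hv]
    exact hcert ⟨o, ho⟩

theorem inst_state_of_hasType {I : InfoBase} (hP : ∀ r ∈ P, r.WellFormed)
    (hI : (certModel P g n).Legal I) {w : ℕ} (hw : certDiagram.HasType I w 0) :
    Fact.inst w 1 ∈ I ∨ Fact.inst w 2 ∈ I := by
  obtain ⟨d, hd, hsub⟩ := hw
  rcases certDiagram_sub.1 hsub with rfl | ⟨-, rfl | rfl⟩
  · exact (((certModel_legal_iff hP).1 hI).2.1 w hd).elim
  · exact Or.inl hd
  · exact Or.inr hd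

theorem hasType_of_inst_state {I : InfoBase} {w s : ℕ} (hs : s = 1 ∨ s = 2)
    (h : Fact.inst w s ∈ I) : certDiagram.HasType I w 0 :=
  ⟨s, h, certDiagram_sub.2 (Or.inr ⟨rfl, hs⟩)⟩

/-- No task makes an artifact instance leave the termination state. -/
theorem inst_final_of_exec (hP : ∀ r ∈ P, r.WellFormed) {t : Task}
    (ht : t = createTask ∨ t = completeTask) {self : Option ℕ} {w o : ℕ} {I J : InfoBase}
    (hI : (certModel P g n).Legal I) (h : t.Exec (certModel P g n) certArtifact self (some w) I J)
    (ho : Fact.inst o 2 ∈ I) : Fact.inst o 2 ∈ J := by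
  obtain ⟨s, hs, hpost, hs2⟩ : ∃ s, (s = 1 ∨ s = 2) ∧ t.post = .oclIsTypeOf 0 s ∧
      (t.creates = false → s = 2) := by
    rcases ht with rfl | rfl
    · exact ⟨1, Or.inl rfl, rfl, by simp [createTask]⟩
    · exact ⟨2, Or.inr rfl, rfl, fun _ => rfl⟩
  obtain ⟨hself, htype, π, -, hadm, hmin⟩ := h
  obtain ⟨hJ, hwJ, hnew⟩ := (certModel_admissible_iff hpost).1 hadm
  have hinst := ((certModel_legal_iff hP).1 hI).1
  have hinstJ := ((certModel_legal_iff hP).1 hJ).1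
  -- The object `w` is either fresh or an artifact instance in one of its states; it is never a step
  -- or a pair.
  have hw : ∀ c, Fact.inst w c ∈ I → c = 1 ∨ c = 2 := by
    intro c hc
    by_cases hcr : t.creates = true
    · exact ((hnew hcr).1 ⟨c, hc⟩).elim
    · rw [if_neg hcr] at hself
      rcases inst_state_of_hasType hP hI (htype w hself.symm) with h | h
      · exact Or.inl (hinst.inst_unique w c 1 hc h)
      · exact Or.inr (hinst.inst_unique w c 2 hc h)
  by_cases how : o = w
  · subst how
    have hcr : t.creates = false := by
      by_contra hcr
      exact (hnew (by simpa using hcr)).1 ⟨2, ho⟩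
    rwa [hs2 hcr] at hwJ
  -- Once a certificate is present, changing only the class of `w` is admissible. It changes no more
  -- than `J` does, so minimality forces `J` to be this base, in which `o` keeps its state.
  · have hmove : t.Admissible (certModel P g n) certArtifact π (some w) I (moveTo I w s) := by
      refine (certModel_admissible_iff hpost).2 ⟨certModel_legal_moveTo hP hI ho hs hw,
        Finset.mem_insert_self .., fun hcr => ⟨(hnew hcr).1, ?_⟩⟩
      exact hasType_of_inst_state hs (Finset.mem_insert_self ..)
    rw [← hmin _ hmove ?_]
    · simp [moveTo, ho, how]
    · intro f hf
      rw [Finset.mem_symmDiff] at hf ⊢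
      rcases hf with ⟨hfI, hf⟩ | ⟨hf, hfI⟩
      · refine Or.inl ⟨hfI, fun hfJ => hf ?_⟩
        -- If `J` keeps a state of `w`, that state is `s`, since classes are unique.
        by_cases hfw : f = Fact.inst w 1 ∨ f = Fact.inst w 2
        · have : f = Fact.inst w s := by
            rcases hfw with rfl | rfl
            · rw [hinstJ.inst_unique w 1 s hfJ hwJ]
            · rw [hinstJ.inst_unique w 2 s hfJ hwJ]
          rw [this]
          exact Finset.mem_insert_self ..
        · exact Finset.mem_insert_of_mem (by simpa [hfI] using hfw)
      · refine Or.inr ⟨?_, hfI⟩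
        rcases Finset.mem_insert.1 hf with rfl | hf
        · exact hwJ
        · exact (hfI (Finset.mem_sdiff.1 hf).1).elim

/-- The running activities that occur in reachable configurations. -/
def ProcOk (I : InfoBase) (p : Proc) : Prop :=
  p.art = 0 ∧ ((p.trans = 0 ∧ p.self = none ∧ p.tokens = {0}) ∨
    ∃ o, p.self = some o ∧ ((p.trans = 0 ∧ p.tokens = {1}) ∨ (p.trans = 1 ∧ p.tokens = {0}) ∨
      (p.trans = 1 ∧ p.tokens = {1} ∧ Fact.inst o 2 ∈ I)))

theorem ProcOk.mono {I J : InfoBase} (h : ∀ o, Fact.inst o 2 ∈ I → Fact.inst o 2 ∈ J) {p : Proc}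
    (hp : ProcOk I p) : ProcOk J p := by
  obtain ⟨ha, hp | ⟨o, ho, hp | hp | hp⟩⟩ := hp
  · exact ⟨ha, Or.inl hp⟩
  · exact ⟨ha, Or.inr ⟨o, ho, Or.inl hp⟩⟩
  · exact ⟨ha, Or.inr ⟨o, ho, Or.inr (Or.inl hp)⟩⟩
  · exact ⟨ha, Or.inr ⟨o, ho, Or.inr (Or.inr ⟨hp.1, hp.2.1, h o hp.2.2⟩)⟩⟩

variable (P g n) in
/-- An invariant of the reachable configurations. -/
structure Invariant (s : Config) : Prop where
  legal : (certModel P g n).Legal s.ib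
  procs : ∀ p ∈ s.procs, ProcOk s.ib p
  nodup : (s.procs.filterMap Proc.self).Nodup

theorem nodup_self_cons {p : Proc} {ps : Multiset Proc} :
    ((p ::ₘ ps).filterMap Proc.self).Nodup ↔
      (∀ q ∈ ps, ∀ o, p.self = some o → q.self ≠ some o) ∧ (ps.filterMap Proc.self).Nodup := by
  rcases h : p.self with _ | o
  · rw [Multiset.filterMap_cons_none _ _ h]
    simp
  · rw [Multiset.filterMap_cons_some _ _ _ h, Multiset.nodup_cons, Multiset.mem_filterMap]
    simp

/-- Only the action nodes change the base. An execution that brings in a certificate is not known to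
leave other objects alone, so about the base `ProcOk` records only facts on the termination state,
the ones that `inst_final_of_exec` preserves. -/
theorem Invariant.step (hP : ∀ r ∈ P, r.WellFormed) {s s' : Config} (hs : Invariant P g n s)
    (h : (certModel P g n).Step s s') : Invariant P g n s' := by
  obtain ⟨hleg, hprocs, hnd⟩ := hs
  cases h with
  | start I ps i k A t Q m self hA ht hQ hm hself hcond =>
    obtain ⟨rfl, rfl⟩ := certModel_artifacts.1 hA
    refine ⟨hleg, ?_, ?_⟩
    · intro p hp
      rcases Multiset.mem_cons.1 hp with rfl | hp
      · rcases certArtifact_transitions.1 ht with ⟨rfl, rfl⟩ | ⟨rfl, rfl⟩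
        · obtain rfl : Q = taskActivity createTask := by simpa [certArtifact_activities] using hQ
          obtain rfl : m = 0 := by simpa [taskActivity_nodes] using hm
          have hself : self = none := by simpa using hself
          exact ⟨rfl, Or.inl ⟨rfl, hself, by rw [taskActivity_outEdges]; rfl⟩⟩
        · obtain rfl : Q = taskActivity completeTask := by simpa [certArtifact_activities] using hQ
          obtain rfl : m = 0 := by simpa [taskActivity_nodes] using hm
          rcases hself with ⟨h, -⟩ | ⟨v, o, -, ho, -⟩
          · simp at h
          · exact ⟨rfl, Or.inr ⟨o, ho, Or.inr (Or.inl ⟨rfl, by rw [taskActivity_outEdges]; rfl⟩)⟩⟩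
      · exact hprocs p hp
    · refine nodup_self_cons.2 ⟨fun q hq o ho => ?_, hnd⟩
      rcases hself with ⟨-, h⟩ | ⟨v, o', -, h, -, hps⟩
      · simp [h] at ho
      · rw [h] at ho
        obtain rfl : o' = o := by simpa using ho
        exact hps q hq
  | fire I J ps i k A t Q m nd self self' rest c d hA ht hQ hm hc hd he hps =>
    obtain ⟨rfl, rfl⟩ := certModel_artifacts.1 hA
    obtain ⟨τ, rfl, hτ⟩ : ∃ τ, Q = taskActivity τ ∧
        ((k = 0 ∧ τ = createTask) ∨ (k = 1 ∧ τ = completeTask)) := by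
      rcases certArtifact_transitions.1 ht with ⟨rfl, rfl⟩ | ⟨rfl, rfl⟩
      · exact ⟨createTask, by simpa [certArtifact_activities] using hQ, Or.inl ⟨rfl, rfl⟩⟩
      · exact ⟨completeTask, by simpa [certArtifact_activities] using hQ, Or.inr ⟨rfl, rfl⟩⟩
    rcases taskActivity_nodes.1 hm with ⟨rfl, rfl⟩ | ⟨rfl, rfl⟩ | ⟨rfl, rfl⟩
    · exact hc.elim
    · obtain rfl : c = {0} := by
        have h : c = ((taskActivity τ).inEdges 1 : Multiset ℕ) := hc
        rwa [taskActivity_inEdges] at h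
      obtain rfl : d = {1} := by
        have h : d = ((taskActivity τ).outEdges 1 : Multiset ℕ) := hd
        rwa [taskActivity_outEdges] at h
      have hp := hprocs _ (Multiset.mem_cons_self _ _)
      -- An activity holds a single token. If the action can consume one from edge `0`, nothing
      -- remains; a token on edge `1` means that the action is already done.
      have htok : ∀ x : ℕ, rest + {0} = {x} → rest = 0 ∧ x = 0 := by
        intro x hx
        have h0 : 0 ∈ ({x} : Multiset ℕ) := hx ▸ by simp
        have hx0 : x = 0 := (Multiset.mem_singleton.1 h0).symm
        subst hx0
        exact ⟨by simpa using hx, rfl⟩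
      have hexec : τ.Exec (certModel P g n) certArtifact self self' I J := he
      obtain ⟨rfl, w, rfl⟩ : rest = 0 ∧ ∃ w, self' = some w := by
        rcases hp with ⟨-, ⟨hk, hself, htk⟩ | ⟨o, ho, ⟨-, h⟩ | ⟨hk, h⟩ | ⟨-, h, -⟩⟩⟩
        · refine ⟨(htok _ htk).1, ?_⟩
          obtain rfl : τ = createTask := by
            rcases hτ with h | h
            · exact h.2
            · exact absurd (hk.symm.trans h.1) (by simp)
          obtain ⟨-, -, π, -, hadm, -⟩ := hexec
          obtain ⟨w, hw, -⟩ := hadm.2.2.2 rfl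
          exact ⟨w, hw⟩
        · exact absurd (htok _ h).2 (by simp)
        · refine ⟨(htok _ h).1, o, ?_⟩
          obtain rfl : τ = completeTask := by
            rcases hτ with h | h
            · exact absurd (hk.symm.trans h.1) (by simp)
            · exact h.2
          have := hexec.1
          rw [if_neg (by simp [completeTask])] at this
          exact this.trans ho
        · exact absurd (htok _ h).2 (by simp)
      have hτ' : τ = createTask ∨ τ = completeTask := hτ.imp And.right And.right
      have hframe : ∀ o, Fact.inst o 2 ∈ I → Fact.inst o 2 ∈ J :=
        fun o ho => inst_final_of_exec hP hτ' hleg hexec ho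
      obtain ⟨-, -, π, -, hadm, -⟩ := hexec
      refine ⟨hadm.1, ?_, ?_⟩
      · intro p hp
        rcases Multiset.mem_cons.1 hp with rfl | hp
        · refine ⟨rfl, Or.inr ⟨w, rfl, ?_⟩⟩
          rcases hτ with ⟨rfl, rfl⟩ | ⟨rfl, rfl⟩
          · exact Or.inl ⟨rfl, zero_add _⟩
          · exact Or.inr (Or.inr ⟨rfl, zero_add _,
              ((certModel_admissible_iff (s := 2) rfl).1 hadm).2.1⟩)
        · exact (hprocs p (Multiset.mem_cons_of_mem hp)).mono hframe
      · exact nodup_self_cons.2 ⟨hps, (nodup_self_cons.1 hnd).2⟩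
    · exact hc.elim
  | finish I ps i k A t Q m o e tokens =>
    exact ⟨hleg, fun p hp => hprocs p (Multiset.mem_cons_of_mem hp), (nodup_self_cons.1 hnd).2⟩

/-! ### Reachability of the termination state. -/

theorem mem_lfp_reachOp {s : Config} {x : ℕ} :
    s ∈ OrderHom.lfp ((certModel P g n).reachOp certArtifact x) ↔
      certDiagram.HasType s.ib x 2 ∨ (certDiagram.HasType s.ib x 0 ∧
        ∃ s', (certModel P g n).Step s s' ∧
          s' ∈ OrderHom.lfp ((certModel P g n).reachOp certArtifact x)) := by
  conv_lhs => rw [← OrderHom.map_lfp]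
  rfl

/-- If the goal is derivable, then every artifact instance can reach its termination state. -/
theorem Invariant.mem_lfp (hP : ∀ r ∈ P, r.WellFormed) {y z : ℕ}
    (hd : Derivable P ⟨g, n, y, z⟩) {s : Config} (hs : Invariant P g n s) {x : ℕ}
    (hx : certDiagram.HasType s.ib x 0) :
    s ∈ OrderHom.lfp ((certModel P g n).reachOp certArtifact x) := by
  have hfinal : ∀ s : Config, Fact.inst x 2 ∈ s.ib →
      s ∈ OrderHom.lfp ((certModel P g n).reachOp certArtifact x) :=
    fun s h => mem_lfp_reachOp.2 (Or.inl ((hasType_iff_inst (by simp)).2 h))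
  have hnext : ∀ {s s' : Config}, Fact.inst x 1 ∈ s.ib → (certModel P g n).Step s s' →
      s' ∈ OrderHom.lfp ((certModel P g n).reachOp certArtifact x) →
      s ∈ OrderHom.lfp ((certModel P g n).reachOp certArtifact x) :=
    fun h1 hst hs' =>
      mem_lfp_reachOp.2 (Or.inr ⟨hasType_of_inst_state (Or.inl rfl) h1, _, hst, hs'⟩)
  -- From a started completion: a legal base with `x` terminated exists by derivability, so the
  -- completing task has an execution.
  have hrun : ∀ (I : InfoBase) (ps : Multiset Proc), Fact.inst x 1 ∈ I →
      (∀ q ∈ ps, q.self ≠ some x) → (⟨I, ⟨0, 1, some x, {0}⟩ ::ₘ ps⟩ : Config) ∈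
        OrderHom.lfp ((certModel P g n).reachOp certArtifact x) := by
    intro I ps h1 hps
    obtain ⟨J₀, hJ₀, hx₀⟩ := exists_legal_of_derivable hP hd x
    have hadm : completeTask.Admissible (certModel P g n) certArtifact (fun _ => 0) (some x) I J₀ :=
      (certModel_admissible_iff (s := 2) rfl).2 ⟨hJ₀, hx₀, by simp [completeTask]⟩
    obtain ⟨J, hJ⟩ := Task.exists_exec (t := completeTask) (self := some x) (self' := some x) rfl
      (fun o ho => by
        obtain rfl : x = o := by simpa using ho
        exact hasType_of_inst_state (Or.inl rfl) h1) trivial hadm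
    have hxJ : Fact.inst x 2 ∈ J := by
      obtain ⟨-, -, π, -, hadm, -⟩ := hJ
      exact ((certModel_admissible_iff (s := 2) rfl).1 hadm).2.1
    refine hnext h1 ?_ (hfinal ⟨J, ⟨0, 1, some x, 0 + {1}⟩ ::ₘ ps⟩ hxJ)
    exact Model.Step.fire I J ps 0 1 certArtifact ⟨some 1, 1, .tt, 2⟩ (taskActivity completeTask) 1
      (.action completeTask) (some x) (some x) 0 {0} {1} rfl rfl rfl rfl rfl rfl hJ
      (fun q hq o ho => ho ▸ hps q hq)
  have hidle : ∀ (I : InfoBase) (ps : Multiset Proc), Fact.inst x 1 ∈ I →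
      (∀ q ∈ ps, q.self ≠ some x) → (⟨I, ps⟩ : Config) ∈
        OrderHom.lfp ((certModel P g n).reachOp certArtifact x) := by
    intro I ps h1 hps
    refine hnext h1 ?_ (hrun I ps h1 hps)
    exact Model.Step.start I ps 0 1 certArtifact ⟨some 1, 1, .tt, 2⟩ (taskActivity completeTask) 0
      (some x) rfl rfl rfl rfl (Or.inr ⟨1, x, rfl, rfl, h1, hps⟩) trivial
  obtain ⟨I, ps⟩ := s
  rcases inst_state_of_hasType hP hs.legal hx with h1 | h2
  -- An instance in state `1` is idle, or is run by exactly one process, whose possible stages are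
  -- listed by `ProcOk`.
  · by_cases hps : ∀ q ∈ ps, q.self ≠ some x
    · exact hidle I ps h1 hps
    · push Not at hps
      obtain ⟨⟨art, k, self, tokens⟩, hp, hpx⟩ := hps
      obtain ⟨hart, hok⟩ := hs.procs _ hp
      obtain ⟨ps, rfl⟩ := Multiset.exists_cons_of_mem hp
      have hps : ∀ q ∈ ps, q.self ≠ some x :=
        fun q hq => (nodup_self_cons.1 hs.nodup).1 q hq x hpx
      dsimp only at hart hpx hok
      subst hart hpx
      rcases hok with ⟨-, h, -⟩ | ⟨o, ho, ⟨rfl, rfl⟩ | ⟨rfl, rfl⟩ | ⟨-, -, h2⟩⟩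
      · simp at h
      -- The creating activity is still waiting to end. It can, as `x` is in its target state, and
      -- then `x` is idle.
      · refine hnext h1 ?_ (hidle I ps h1 hps)
        exact Model.Step.finish I ps 0 0 certArtifact ⟨none, 0, .tt, 1⟩ (taskActivity createTask) 2
          x 1 {1} rfl rfl rfl rfl (by simp [taskActivity_inEdges]) (by simp) h1
      · exact hrun I ps h1 hps
      · obtain rfl : x = o := by simpa using ho
        exact hfinal _ h2
  · exact hfinal _ h2

theorem Model.Step.legal {B : Model} {s s' : Config} (h : B.Step s s') (hs : B.Legal s.ib) :
    B.Legal s'.ib := by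
  cases h with
  | start => exact hs
  | finish => exact hs
  | fire I J ps i k A t Q m nd self self' rest c d hA ht hQ hm hc hd he hps =>
    cases nd with
    | action t =>
      obtain ⟨-, -, π, -, hadm, -⟩ := he
      exact hadm.1
    | _ => exact he.2 ▸ hs

/-- The model satisfies artifact termination iff the goal is derivable. -/
theorem certModel_terminates_iff (hP : ∀ r ∈ P, r.WellFormed) :
    (certModel P g n).Terminates ∅ ↔ ∃ y z, Derivable P ⟨g, n, y, z⟩ := by
  constructor
  · intro hterm
    have hgfp : ∀ s ∈ OrderHom.gfp (certModel P g n).terminationOp,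
        (∀ x, certDiagram.HasType s.ib x 0 →
          s ∈ OrderHom.lfp ((certModel P g n).reachOp certArtifact x)) ∧
        ∀ s', (certModel P g n).Step s s' → s' ∈ OrderHom.gfp (certModel P g n).terminationOp := by
      intro s hs
      rw [← OrderHom.map_gfp] at hs
      exact ⟨fun x hx => hs.1 certArtifact (List.mem_cons_self ..) x hx, hs.2⟩
    -- The empty base satisfies termination vacuously as far as its own instances go, so the run
    -- first creates the instance `0`.
    have hadm : createTask.Admissible (certModel P g n) certArtifact (fun _ => 0) (some 0) ∅
        {Fact.inst 0 1} := by
      refine (certModel_admissible_iff (s := 1) rfl).2 ⟨(certModel_legal_iff hP).2 ⟨?_, ?_, ?_⟩,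
        by simp, fun _ => ⟨by simp [InfoBase.Exists], hasType_of_inst_state (Or.inl rfl) (by simp)⟩⟩
      · constructor
        case val_required =>
          intro a d o hd _ ho
          obtain ⟨-, rfl⟩ := certDiagram_attrs.1 hd
          dsimp only at ho
          rw [hasType_iff_inst (by split_ifs <;> simp)] at ho
          split_ifs at ho <;> simp at ho
        all_goals simp +contextual [certDiagram]
      · simp
      · simp
    obtain ⟨J, hJ⟩ := Task.exists_exec (t := createTask) (self := none) (self' := some 0) rfl (by simp) trivial hadm
    have hJ1 : (certModel P g n).Legal J ∧ Fact.inst 0 1 ∈ J := by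
      obtain ⟨-, -, π, -, hadm, -⟩ := hJ
      exact ⟨hadm.1, ((certModel_admissible_iff (s := 1) rfl).1 hadm).2.1⟩
    have h1 := (hgfp _ hterm).2 _ (Model.Step.start ∅ 0 0 0 certArtifact ⟨none, 0, .tt, 1⟩
      (taskActivity createTask) 0 none rfl rfl rfl rfl (Or.inl ⟨rfl, rfl⟩) trivial)
    have h2 := (hgfp _ h1).2 _ (Model.Step.fire ∅ J 0 0 0 certArtifact ⟨none, 0, .tt, 1⟩
      (taskActivity createTask) 1 (.action createTask) none (some 0) 0 {0} {1} rfl rfl rfl rfl rfl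
      rfl hJ (by simp))
    have h3 := (hgfp _ h2).1 0 (hasType_of_inst_state (Or.inl rfl) hJ1.2)
    by_contra hnd
    -- If the goal is not derivable, no legal base has a terminated instance. Steps preserve
    -- legality, so the illegal configurations form a pre-fixed point and contain the least one,
    -- contradicting legality of `J`.
    have hle : OrderHom.lfp ((certModel P g n).reachOp certArtifact 0) ≤
        {s | ¬ (certModel P g n).Legal s.ib} := by
      refine OrderHom.lfp_le _ ?_
      rintro s (hs | ⟨-, s', hst, hs'⟩) hleg
      · exact hnd (derivable_of_legal hP hleg ((hasType_iff_inst (c := 2) (by simp)).1 hs))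
      · exact hs' (hst.legal hleg)
    exact hle h3 hJ1.1
  · rintro ⟨y, z, hd⟩
    -- Coinduction: the invariant is a post-fixed point of the termination operator.
    have hle : {s | Invariant P g n s} ≤ OrderHom.gfp (certModel P g n).terminationOp := by
      refine OrderHom.le_gfp _ ?_
      intro s hs
      refine ⟨fun A hA x hx => ?_, fun s' hst => Invariant.step hP hs hst⟩
      obtain rfl : A = certArtifact := by simpa [certModel] using hA
      exact Invariant.mem_lfp hP hd hs hx
    exact hle ⟨certModel_legal_empty hP g n, by simp, by simp⟩

end

/-! ### Computability of the reduction -/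

theorem primrec_code_and {φ ψ : ℕ → OCL} (hφ : Primrec fun i => (φ i).code)
    (hψ : Primrec fun i => (ψ i).code) : Primrec fun i => (OCL.and (φ i) (ψ i)).code :=
  Primrec.encode.comp (.pair (.const 8) (Primrec.encode.comp (.pair hφ hψ)))

theorem primrec_code_exists {φ : ℕ → OCL} (p : Path) (x : ℕ) (hφ : Primrec fun i => (φ i).code) :
    Primrec fun i => (OCL.exists_ p x (φ i)).code :=
  Primrec.encode.comp (.pair (.const 10) (Primrec.encode.comp
    (.pair (.const p.code) (.pair (.const x) hφ))))

theorem primrec_code_const (s : ValExpr) {v : ℕ → ℕ} (hv : Primrec v) :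
    Primrec fun i => (OCL.valIncludesAll s (.const (v i))).code :=
  Primrec.encode.comp (.pair (.const 3) (Primrec.encode.comp
    (.pair (.const s.code) (Primrec.encode.comp (.pair (.const 0) hv)))))

theorem primrec_code_onTermination {φ : ℕ → OCL} (hφ : Primrec fun i => (φ i).code) :
    Primrec fun i => (onTermination (φ i)).code :=
  Primrec.encode.comp (.pair (.const 9) (Primrec.encode.comp
    (.pair (.const (OCL.isEmpty (allOf 2)).code) hφ)))

theorem primrec_code_inputOCL : Primrec fun i => (inputOCL i).code :=
  primrec_code_exists _ _ (primrec_code_and (primrec_code_const _ (.const 0))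
    (primrec_code_and (primrec_code_const _ .id) (primrec_code_const _ .succ)))

theorem primrec_code_goalOCL (g : ℕ) : Primrec fun n => (goalOCL g n).code :=
  primrec_code_exists _ _ (primrec_code_and (primrec_code_const _ (.const g))
    (primrec_code_const _ .id))

/-- The program is fixed and contributes constants. Only the goal and the list of input constraints
vary with `n`. -/
theorem primrec_code_certModel (P : List Rule) (g : ℕ) :
    Primrec fun n => (certModel P g n).code := by
  have hlist : Primrec fun n => ((certModel P g n).constraints.map OCL.code) := by
    have hinput : Primrec fun n : ℕ =>
        (List.range n).map fun i => (onTermination (inputOCL i)).code :=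
      Primrec.list_map Primrec.list_range
        ((primrec_code_onTermination primrec_code_inputOCL).comp Primrec.snd)
    have hfixed : Primrec fun n : ℕ => [(onTermination transOCL).code,
        (onTermination irreflOCL).code, (onTermination succOCL).code,
        (onTermination (stepOCL P)).code, (onTermination (goalOCL g n)).code] := by
      refine Primrec.list_cons.comp (.const _) (Primrec.list_cons.comp (.const _)
        (Primrec.list_cons.comp (.const _) (Primrec.list_cons.comp (.const _)
          (Primrec.list_cons.comp ?_ (.const [])))))
      exact primrec_code_onTermination (primrec_code_goalOCL g)
    refine (Primrec.list_append.comp hfixed hinput).of_eq fun n => ?_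
    simp [certModel, certOCL, Function.comp_def]
  exact Primrec.encode.comp (.pair (.const certDiagram.code)
    (.pair hlist (.const ([certArtifact].map Artifact.code))))

end BAUML

/-! ### Undecidability. -/

open Nat.Partrec in
/-- Some partial recursive function has an undecidable domain. -/
theorem exists_code_not_computable_dom :
    ∃ c : Code, ¬ ∃ f : ℕ → Bool, Computable f ∧ ∀ n, f n = true ↔ (c.eval n).Dom := by
  -- The function that runs the program with number `m` on input `0`; deciding its domain would
  -- decide halting on `0`.
  have hpart : Partrec fun m : ℕ => (Denumerable.ofNat Code m).eval 0 :=
    Code.eval_part.comp (Computable.ofNat Code) (Computable.const 0)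
  obtain ⟨c, hc⟩ := Code.exists_code.1 (Partrec.nat_iff.1 hpart)
  refine ⟨c, fun ⟨f, hf, h⟩ => ComputablePred.halting_problem 0 ?_⟩
  refine ComputablePred.computable_iff.2
    ⟨fun d => f (Encodable.encode d), hf.comp Computable.encode, funext fun d => propext ?_⟩
  rw [h, hc]
  simp

theorem mainTheorem4 :
    ¬ ∃ f : ℕ → Bool, Computable f ∧
      ∀ B : BAUML.Model, B.WellFormed → B.Unidirectional → B.Legal ∅ →
        (f B.code = true ↔ B.Terminates ∅) := by
  rintro ⟨f, hf, h⟩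
  obtain ⟨c, hc⟩ := exists_code_not_computable_dom
  have hP := BAUML.program_wellFormed c
  refine hc ⟨fun n => f (BAUML.certModel (BAUML.program c) (BAUML.codeTag c) n).code,
    hf.comp (BAUML.primrec_code_certModel _ _).to_comp, fun n => ?_⟩
  rw [h _ (BAUML.certModel_wellFormed hP _ n) (BAUML.certModel_unidirectional _ _ n)
    (BAUML.certModel_legal_empty hP _ n), BAUML.certModel_terminates_iff hP,
    BAUML.derivable_program_iff]
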